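/- Let $\mathbf K=(K,\le_{\mathbf K})$ be an abstract elementary class (AEC) in a finitary vocabulary $\tau$. Its Löwenheim--Skolem--Tarski number $\mathrm{LS}(\mathbf K)$ is the least cardinal $\kappa\ge|\tau|+\aleph_0$ such that for all $N\in\mathbf K$ and $A\subseteq|N|$ there is $M\le_{\mathbf K}N$ with $A\subseteq|M|$ and $\|M\|\le|A|+\kappa$. Let $\lambda\ge\mathrm{LS}(\mathbf K)$ be an infinite cardinal. For a cardinal $\mu$ let $\mathbf K_\mu$ be the class of models in $\mathbf K$ of cardinality $\mu$ and $\mathbb I(\mathbf K,\mu)$ the number of isomorphism classes of models in $\mathbf K_\mu$. A \emph{pre-type} is a triple $(a,M,N)$ with $M,N\in\mathbf K_\lambda$, $M\le_{\mathbf K}N$ and $a\in|N|\setminus|M|$; $K^3_\lambda$ is the class of pre-types. A map $f:M\to N$ is a \emph{$\mathbf K$-embedding} if it is an isomorphism of $M$ onto some $f[M]\le_{\mathbf K}N$. Write $(a_0,M_0,N_0)\le_h(a_1,M_1,N_1)$ if $h:N_0\to N_1$ and $h\restriction M_0:M_0\to M_1$ are $\mathbf K$-embeddings and $h(a_0)=a_1$;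 write $(a_0,M_0,N_0)\le(a_1,M_1,N_1)$, and say that the second lies \emph{above} the first, if this holds with $h$ an inclusion (which, up to renaming elements of $M_1,N_1$, is the same as $\le_h$ for some $h$). Two pre-types $(a_0,M,N_0)$, $(a_1,M,N_1)$ with the same $M$ are related by $E_{at}$ if there are $R\in\mathbf K$ and $\mathbf K$-embeddings $f_l:N_l\to R$ fixing $M$ pointwise with $f_0(a_0)=f_1(a_1)$; let $E$ be the transitive closure of $E_{at}$ and let $\mathbf{tp}(a/M,N)$ be the $E$-class of $(a,M,N)$. A pre-type $(a,M_0,N_0)$ is \emph{minimal} if, whenever $(a,M_0,N_0)\le_{h_l}(a_l,M_1,N_1^l)$ for $l=1,2$ and $h_1\restriction M_0=h_2\restriction M_0$, then $\mathbf{tp}(a_1/M_1,N_1^1)=\mathbf{tp}(a_2/M_1,N_1^2)$. A type is \emph{minimal} if it is $\mathbf{tp}(a/M,N)$ for some minimal pre-type $(a,M,N)$. The frame $\mathfrak s_{min}$ on $\mathbf K_\lambda$ has the minimal types as its basic types; for $M_0\le_{\mathbf K}M_1\le_{\mathbf K}N$ in $\mathbf K_\lambda$ and $a\in|N|\setminus|M_1|$,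 the type $\mathbf{tp}(a/M_1,N)$ does not fork over $M_0$ if and only if $\mathbf{tp}(a/M_0,N)$ is minimal. Suppose that $2^{\lambda}<2^{\lambda^+}<2^{\lambda^{++}}$, that $2^{\lambda^+}>\lambda^{++}$, that $$(\ast)_\lambda:\qquad \mathbb I(\mathbf K,\lambda)=\mathbb I(\mathbf K,\lambda^+)=1\le\mathbb I(\mathbf K,\lambda^{++})<2^{\lambda^{++}},$$ and that $\mathbf K_{\lambda^{+++}}=\emptyset$. Then: 1. Minimal pre-types are dense in $K^3_\lambda$: for every pre-type there is a minimal pre-type above it. 2. $\mathfrak s_{min}$ has weak density: whenever $M\le_{\mathbf K}N$ are in $\mathbf K_\lambda$ and $M\ne N$, there are $a\in|N|\setminus|M|$ and a pre-type $(a,M',N')\ge(a,M,N)$ such that $\mathbf{tp}(a/M',N')$ is a basic type of $\mathfrak s_{min}$, i.e. a minimal type over $M'$. -/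

import Mathlib

open scoped FirstOrder
open Cardinal

universe u

/-- An abstract elementary class in the vocabulary `L`. `Mem M` says that the `L`-structure `M`
belongs to the class; for a substructure `M` of `N`, `Strong M` says `M ≤_K N`. If `M₁ ⊆ M₂`
are substructures of `N`, then `M₁` regarded as a substructure of `M₂` is
`M₁.comap M₂.subtype.toHom`. -/
structure AEC (L : FirstOrder.Language.{u, u}) where
  Mem : (M : Type u) → [L.Structure M] → Prop
  Strong : {N : Type u} → [L.Structure N] → L.Substructure N → Prop
  /-- `≤_K` is a relation between members of the class. -/
  mem_of_strong : ∀ {N : Type u} [L.Structure N] {M : L.Substructure N},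
    Strong M → Mem M ∧ Mem N
  /-- closure under isomorphism -/
  mem_equiv : ∀ {M N : Type u} [L.Structure M] [L.Structure N], (M ≃[L] N) → Mem M → Mem N
  strong_equiv : ∀ {N N' : Type u} [L.Structure N] [L.Structure N'] (e : N ≃[L] N')
    {M : L.Substructure N}, Strong M → Strong (M.map e.toHom)
  /-- reflexivity and transitivity of `≤_K` -/
  strong_top : ∀ {N : Type u} [L.Structure N], Mem N → Strong (⊤ : L.Substructure N)
  strong_trans : ∀ {N : Type u} [L.Structure N] {M₁ M₂ : L.Substructure N}, M₁ ≤ M₂ →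
    Strong (M₁.comap M₂.subtype.toHom) → Strong M₂ → Strong M₁
  /-- coherence -/
  coherence : ∀ {N : Type u} [L.Structure N] {M₁ M₂ : L.Substructure N}, M₁ ≤ M₂ →
    Strong M₁ → Strong M₂ → Strong (M₁.comap M₂.subtype.toHom)
  /-- the union `U` of a well-ordered `≤_K`-increasing chain belongs to the class and
  `≤_K`-extends every member of the chain -/
  strong_chain : ∀ {ι : Type u} [LinearOrder ι] [WellFoundedLT ι] [Nonempty ι]
    {U : Type u} [L.Structure U] (S : ι → L.Substructure U),
    Monotone S → (∀ i j, i ≤ j → Strong ((S i).comap (S j).subtype.toHom)) →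
    (⨆ i, S i) = ⊤ → ∀ i, Strong (S i)
  /-- smoothness: if every member of the chain is `≤_K N`, so is the union -/
  strong_iSup : ∀ {ι : Type u} [LinearOrder ι] [WellFoundedLT ι] [Nonempty ι]
    {N : Type u} [L.Structure N] (S : ι → L.Substructure N),
    Monotone S → (∀ i, Strong (S i)) → Strong (⨆ i, S i)
  /-- the Löwenheim–Skolem–Tarski axiom -/
  exists_LS : ∃ κ : Cardinal.{u}, ℵ₀ ≤ κ ∧ L.card ≤ κ ∧
    ∀ {N : Type u} [L.Structure N], Mem N → ∀ A : Set N,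
      ∃ M : L.Substructure N, Strong M ∧ A ⊆ (M : Set N) ∧ #M ≤ #A + κ

namespace AEC

variable {L : FirstOrder.Language.{u, u}} (K : AEC L)

/-- The Löwenheim–Skolem–Tarski number `LS(K)`. -/
noncomputable def LS : Cardinal.{u} :=
  sInf {κ : Cardinal.{u} | ℵ₀ ≤ κ ∧ L.card ≤ κ ∧
    ∀ {N : Type u} [L.Structure N], K.Mem N → ∀ A : Set N,
      ∃ M : L.Substructure N, K.Strong M ∧ A ⊆ (M : Set N) ∧ #M ≤ #A + κ}

/-- The members of `K` of cardinality `μ`. -/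
def Models (μ : Cardinal.{u}) : Type (u + 1) :=
  {M : CategoryTheory.Bundled.{u} L.Structure // K.Mem M ∧ #M = μ}

/-- Isomorphism of members of `K` of cardinality `μ`. -/
def modelsSetoid (μ : Cardinal.{u}) : Setoid (K.Models μ) :=
  Setoid.comap Subtype.val FirstOrder.Language.equivSetoid

/-- `𝕀(K, μ)`: the number of isomorphism classes of members of `K` of cardinality `μ`. -/
noncomputable def numModels (μ : Cardinal.{u}) : Cardinal.{u + 1} :=
  #(Quotient (K.modelsSetoid μ))

/-- The assertion `(∗)_lam`:
`𝕀(K, lam) = 𝕀(K, lam⁺) = 1 ≤ 𝕀(K, lam⁺⁺) < 2 ^ lam⁺⁺`. -/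
def Star (lam : Cardinal.{u}) : Prop :=
  K.numModels lam = 1 ∧ K.numModels (Order.succ lam) = 1 ∧
    1 ≤ K.numModels (Order.succ (Order.succ lam)) ∧
    K.numModels (Order.succ (Order.succ lam)) <
      Cardinal.lift.{u + 1} (2 ^ Order.succ (Order.succ lam))

/-- `f : M → N` is a `K`-embedding: an isomorphism of `M` with some `f[M] ≤_K N`. -/
def IsEmb {M N : Type u} [L.Structure M] [L.Structure N] (f : M ↪[L] N) : Prop :=
  K.Strong f.toHom.range

theorem range_comp_equiv {M N N' : Type u} [L.Structure M] [L.Structure N] [L.Structure N']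
    (f : M ↪[L] N) (g : N ↪[L] N') :
    ((g.comp f).toHom.range).comap (g.toHom.range).subtype.toHom
      = (f.toHom.range).map g.equivRange.toHom := by
  ext ⟨y, hy⟩
  simp only [FirstOrder.Language.Substructure.mem_comap, FirstOrder.Language.Substructure.mem_map,
    FirstOrder.Language.Hom.mem_range]
  constructor
  · rintro ⟨x, hx⟩
    exact ⟨f x, ⟨x, rfl⟩, Subtype.ext hx⟩
  · rintro ⟨_, ⟨x, rfl⟩, hx⟩
    exact ⟨x, congrArg Subtype.val hx⟩

/-- `K`-embeddings compose. -/
theorem IsEmb.comp {M N N' : Type u} [L.Structure M] [L.Structure N] [L.Structure N']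
    {f : M ↪[L] N} {g : N ↪[L] N'} (hf : K.IsEmb f) (hg : K.IsEmb g) :
    K.IsEmb (g.comp f) := by
  refine K.strong_trans (M₂ := g.toHom.range) ?_ ?_ hg
  · rintro _ ⟨x, rfl⟩
    exact ⟨f x, rfl⟩
  · rw [range_comp_equiv]
    exact K.strong_equiv _ hf

/-- The identity of a member of `K` is a `K`-embedding. -/
theorem isEmb_refl {M : Type u} [L.Structure M] (h : K.Mem M) :
    K.IsEmb (FirstOrder.Language.Embedding.refl L M) := by
  have : (FirstOrder.Language.Embedding.refl L M).toHom.range = ⊤ := by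
    ext x
    simp
  rw [IsEmb, this]
  exact K.strong_top h

/-- A pre-type `(a, M, N) ∈ K³_lam` with base `M`. The relation `M ≤_K N` is represented by a
`K`-embedding `emb : M → N`, which is an inclusion up to the names of the elements of `N`.
Membership of `M` and `N` in `K` follows from `isEmb`. -/
structure PreType (lam : Cardinal.{u}) (M : Type u) [L.Structure M] where
  N : Type u
  [str : L.Structure N]
  card_base : #M = lam
  card_top : #N = lam
  emb : M ↪[L] N
  isEmb : K.IsEmb emb
  a : N
  a_notMem : a ∉ Set.range emb

attribute [instance] PreType.str

namespace PreType

variable {K} {lam : Cardinal.{u}}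

/-- `(a₀, M, N₀) E_at (a₁, M, N₁)`: there are `R ∈ K` (of any cardinality) and `K`-embeddings
`N₀ → R`, `N₁ → R` which agree on `M` and identify `a₀` with `a₁`. -/
def EAt {M : Type u} [L.Structure M] (p q : K.PreType lam M) : Prop :=
  ∃ (R : Type u) (_ : L.Structure R) (f : p.N ↪[L] R) (g : q.N ↪[L] R),
    K.IsEmb f ∧ K.IsEmb g ∧ (∀ x : M, f (p.emb x) = g (q.emb x)) ∧ f p.a = g q.a

/-- The equivalence relation `E`: the transitive closure of `E_at`. -/
def setoid (K : AEC L) (lam : Cardinal.{u}) (M : Type u) [L.Structure M] :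
    Setoid (K.PreType lam M) where
  r := Relation.TransGen EAt
  iseqv :=
    { refl := fun p => Relation.TransGen.single
        ⟨p.N, p.str, FirstOrder.Language.Embedding.refl L p.N, FirstOrder.Language.Embedding.refl L p.N,
          K.isEmb_refl (K.mem_of_strong p.isEmb).2, K.isEmb_refl (K.mem_of_strong p.isEmb).2,
          fun _ => rfl, rfl⟩
      symm := fun {p q} h => by
        have hs : ∀ p q : K.PreType lam M, EAt p q → EAt q p := by
          rintro p q ⟨R, i, f, g, hf, hg, h, ha⟩
          exact ⟨R, i, g, f, hg, hf, fun x => (h x).symm, ha.symm⟩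
        induction h with
        | single h => exact .single (hs _ _ h)
        | tail _ h ih => exact .head (hs _ _ h) ih
      trans := fun h₁ h₂ => h₁.trans h₂ }

end PreType

/-- `S^na(M)` for `M` in `K` of cardinality `lam`: the nonalgebraic Galois types over `M`. -/
def NaType (lam : Cardinal.{u}) (M : Type u) [L.Structure M] : Type (u + 1) :=
  Quotient (PreType.setoid K lam M)

namespace PreType

variable {K} {lam : Cardinal.{u}}

/-- The Galois type `tp(a / M, N)` of a pre-type `(a, M, N)`. -/
def tp {M : Type u} [L.Structure M] (p : K.PreType lam M) : K.NaType lam M :=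
  Quotient.mk (PreType.setoid K lam M) p

/-- `(a₀, M₀, N₀) ≤_h (a₁, M₁, N₁)`, where `h₀ : M₀ → M₁` is the restriction of `h : N₀ → N₁`. -/
def LeVia {M₀ M₁ : Type u} [L.Structure M₀] [L.Structure M₁]
    (p : K.PreType lam M₀) (q : K.PreType lam M₁) (h₀ : M₀ ↪[L] M₁) (h : p.N ↪[L] q.N) : Prop :=
  K.IsEmb h₀ ∧ K.IsEmb h ∧ (∀ x : M₀, h (p.emb x) = q.emb (h₀ x)) ∧ h p.a = q.a

/-- `(a₀, M₀, N₀) ≤ (a₁, M₁, N₁)`, the inclusions being represented by `K`-embeddings. -/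
def Le {M₀ M₁ : Type u} [L.Structure M₀] [L.Structure M₁]
    (p : K.PreType lam M₀) (q : K.PreType lam M₁) : Prop :=
  ∃ (h₀ : M₀ ↪[L] M₁) (h : p.N ↪[L] q.N), LeVia p q h₀ h

/-- Minimal pre-types. -/
def Minimal {M₀ : Type u} [L.Structure M₀] (p : K.PreType lam M₀) : Prop :=
  ∀ (M₁ : Type u) [L.Structure M₁] (q₁ q₂ : K.PreType lam M₁) (h₀ : M₀ ↪[L] M₁)
    (h₁ : p.N ↪[L] q₁.N) (h₂ : p.N ↪[L] q₂.N),
    LeVia p q₁ h₀ h₁ → LeVia p q₂ h₀ h₂ → q₁.tp = q₂.tp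

end PreType

/-- A minimal type: one of the form `tp(a / M, N)` with `(a, M, N)` minimal. -/
def IsMinimalType {lam : Cardinal.{u}} {M : Type u} [L.Structure M] (t : K.NaType lam M) : Prop :=
  ∃ p : K.PreType lam M, p.Minimal ∧ p.tp = t

/-- Every pre-type has a minimal pre-type above it. -/
def MinimalDense (lam : Cardinal.{u}) : Prop :=
  ∀ (M : Type u) [L.Structure M] (p : K.PreType lam M),
    ∃ (M' : Type u) (_ : L.Structure M') (q : K.PreType lam M'), p.Le q ∧ q.Minimal

/-- The data `(K_lam, nonforking, S^bs)` of a frame in cardinality `lam`. For `M₀ ≤_K M₁ ≤_K N`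
in `K_lam`, given by embeddings `i : M₀ → M₁` and `j : M₁ → N`, and for `a ∈ N`, the proposition
`nf i j a` says that `tp(a / M₁, N)` does not fork over `M₀`. -/
structure Frame (lam : Cardinal.{u}) where
  bs : (M : Type u) → [L.Structure M] → Set (K.NaType lam M)
  nf : {M₀ M₁ N : Type u} → [L.Structure M₀] → [L.Structure M₁] → [L.Structure N] →
    (M₀ ↪[L] M₁) → (M₁ ↪[L] N) → N → Prop

/-- The frame `𝔰_min`: the basic types are the minimal types, and `tp(a / M₁, N)` with `a ∉ M₁`
does not fork over `M₀` when its restriction `tp(a / M₀, N)` to `M₀` is minimal. -/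
def sMin (lam : Cardinal.{u}) : K.Frame lam where
  bs _ _ := {t | K.IsMinimalType t}
  nf {M₀ M₁ N} _ _ _ i j a :=
    #M₁ = lam ∧ K.IsEmb i ∧ K.IsEmb j ∧ a ∉ Set.range j ∧
      ∃ (h₀ : #M₀ = lam) (hN : #N = lam) (hij : K.IsEmb (j.comp i))
        (ha : a ∉ Set.range (j.comp i)),
        K.IsMinimalType (PreType.tp (K := K) (lam := lam)
          { N := N, card_base := h₀, card_top := hN, emb := j.comp i, isEmb := hij,
            a := a, a_notMem := ha })

/-- Weak density for basic types: whenever `M <_K N` are in `K_lam` (the inclusion being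
represented by a non-surjective `K`-embedding `i`), there are `a ∈ N \ M` and a pre-type
`(a, M', N')` above `(a, M, N)` such that `tp(a / M', N')` is basic. -/
def Frame.WeakDensity {K : AEC L} {lam : Cardinal.{u}} (s : K.Frame lam) : Prop :=
  ∀ (M N : Type u) [L.Structure M] [L.Structure N] (hM : #M = lam) (hN : #N = lam)
    (i : M ↪[L] N) (hi : K.IsEmb i), ¬ Function.Surjective i →
    ∃ (a : N) (ha : a ∉ Set.range i) (M' : Type u) (_ : L.Structure M') (q : K.PreType lam M'),
      PreType.Le { N := N, card_base := hM, card_top := hN, emb := i, isEmb := hi,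
                   a := a, a_notMem := ha } q ∧
      q.tp ∈ s.bs M'

end AEC

/-! Everything takes place inside one model `N` of cardinality `λ⁺⁺` without proper extensions. Such
an `N` exists since there are models in `λ⁺⁺` but none in `λ⁺⁺⁺`: otherwise proper extensions could
be iterated `λ⁺⁺⁺` times (`exists_maximal`).

Amalgamation holds in `λ` and in `λ⁺` (`amalgamationProperty_of_numModels_lt`). If it fails in a
categoricity cardinal `μ`, a binary tree of models of height `μ⁺` is built whose two successors at
each node are incompatible, and its branches yield `2 ^ μ⁺` models in `μ⁺`. Either incompatibility
can be kept over one fixed small model, and then counting suffices because `2 ^ μ < 2 ^ μ⁺`; or it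
holds only over the node itself, but one successor has all its extensions amalgamable over the node,
and then weak diamond defeats every possible isomorphism.

With amalgamation, `N` realizes every extension, of the same cardinality, of its strong submodels of
cardinality `λ` or `λ⁺`: an amalgam of `N` with the extension is `N` itself
(`AmalgamationProperty.exists_map_of_maximal`, `exists_map_of_maximal`).

Suppose now that no pre-type above `p` is minimal. Its base embeds in `N` by categoricity in `λ`.
Splitting again and again gives a tree of height `λ⁺` of pre-types above `p` whose bases are
embedded in `N`; the two successors of a node share their base inside `N` but give the distinguished
element different types (`EmbState.exists_split`). Along each branch the union has cardinality `λ⁺`,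
so its top maps into `N` over its base. The image of the distinguished element determines the
branch, because a coincidence would make `N` a witness to equality of types at the splitting node.
Hence `2 ^ λ⁺` branches inject into `N`, against `λ⁺⁺ < 2 ^ λ⁺`. Weak density follows by applying
density to any element outside the small model. -/

namespace AEC

open FirstOrder.Language

variable {L : FirstOrder.Language.{u, u}} (K : AEC L)

/-! ### `K`-embeddings as plain functions, and the Löwenheim–Skolem property above `LS(K)`. -/

section StrongMap

variable {A B C : Type u} [L.Structure A] [L.Structure B] [L.Structure C]

/-- A function between structures that is a `K`-embedding. -/
def IsStrongMap (g : A → B) : Prop :=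
  ∃ e : A ↪[L] B, ⇑e = g ∧ K.IsEmb e

variable {K}

theorem IsEmb.isStrongMap {e : A ↪[L] B} (he : K.IsEmb e) : K.IsStrongMap e :=
  ⟨e, rfl, he⟩

theorem isStrongMap_coe {e : A ↪[L] B} : K.IsStrongMap e ↔ K.IsEmb e := by
  refine ⟨?_, IsEmb.isStrongMap⟩
  rintro ⟨e', h, he'⟩
  rwa [← DFunLike.coe_injective h]

theorem IsStrongMap.injective {g : A → B} (hg : K.IsStrongMap g) : Function.Injective g := by
  obtain ⟨e, rfl, -⟩ := hg
  exact e.injective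

theorem IsStrongMap.comp {g : B → C} {f : A → B} (hg : K.IsStrongMap g) (hf : K.IsStrongMap f) :
    K.IsStrongMap (g ∘ f) := by
  obtain ⟨e, rfl, he⟩ := hf
  obtain ⟨e', rfl, he'⟩ := hg
  exact ⟨e'.comp e, rfl, IsEmb.comp K he he'⟩

theorem isStrongMap_id (h : K.Mem A) : K.IsStrongMap (id : A → A) :=
  ⟨_, rfl, K.isEmb_refl h⟩

theorem isStrongMap_equiv (h : K.Mem A) (e : A ≃[L] B) : K.IsStrongMap e := by
  refine ⟨e.toEmbedding, rfl, ?_⟩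
  have : e.toEmbedding.toHom.range = ⊤ := e.toHom_range
  rw [IsEmb, this]
  exact K.strong_top (K.mem_equiv e h)

theorem IsStrongMap.mem_right {g : A → B} (hg : K.IsStrongMap g) : K.Mem B := by
  obtain ⟨e, rfl, he⟩ := hg
  exact (K.mem_of_strong he).2

theorem IsStrongMap.mem_left {g : A → B} (hg : K.IsStrongMap g) : K.Mem A := by
  obtain ⟨e, rfl, he⟩ := hg
  exact K.mem_equiv e.equivRange.symm (K.mem_of_strong he).1

theorem isStrongMap_subtype {S : L.Substructure A} (h : K.Strong S) :
    K.IsStrongMap (Subtype.val : S → A) := by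
  refine ⟨S.subtype, rfl, ?_⟩
  rwa [IsEmb, Substructure.range_subtype]

/-- An embedding, as a function, determines a bundled embedding. -/
theorem exists_embedding_of_comp {g : B ↪[L] C} {f : A ↪[L] C} {h : A → B} (hgf : ⇑g ∘ h = f) :
    ∃ e : A ↪[L] B, ⇑e = h := by
  have hgf' : ∀ x, g (h x) = f x := fun x => congrFun hgf x
  refine ⟨⟨⟨h, fun x y hxy => f.injective ?_⟩, ?_, ?_⟩, rfl⟩
  · rw [← hgf', ← hgf', hxy]
  · intro n F x
    apply g.injective
    change g (h _) = g (Structure.funMap F (h ∘ x))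
    rw [hgf', f.map_fun, g.map_fun, ← Function.comp_assoc, hgf]
  · intro n R x
    change Structure.RelMap R (h ∘ x) ↔ _
    rw [← g.map_rel, ← f.map_rel, ← Function.comp_assoc, hgf]

/-- Coherence. -/
theorem IsStrongMap.of_comp {g : B → C} {h : A → B} (hg : K.IsStrongMap g)
    (hf : K.IsStrongMap (g ∘ h)) : K.IsStrongMap h := by
  obtain ⟨g, rfl, hg⟩ := hg
  obtain ⟨f, hgf, hf⟩ := hf
  obtain ⟨e, rfl⟩ := exists_embedding_of_comp hgf.symm
  have hfe : f = g.comp e := DFunLike.coe_injective hgf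
  subst hfe
  refine ⟨e, rfl, ?_⟩
  have h1 : (g.comp e).toHom.range ≤ g.toHom.range := by
    rintro _ ⟨x, rfl⟩
    exact ⟨e x, rfl⟩
  have h2 := K.coherence h1 hf hg
  rw [range_comp_equiv] at h2
  have h3 := K.strong_equiv g.equivRange.symm h2
  rw [Substructure.map_map] at h3
  have h4 : g.equivRange.symm.toHom.comp g.equivRange.toHom = Hom.id L B := by
    ext x
    simp
  rwa [h4, Substructure.map_id] at h3

theorem IsStrongMap.strong_range {g : A → B} (hg : K.IsStrongMap g) {S : L.Substructure B}
    (hS : (S : Set B) = Set.range g) : K.Strong S := by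
  obtain ⟨e, rfl, he⟩ := hg
  have : S = e.toHom.range := by
    apply SetLike.coe_injective
    rw [hS]
    exact (Hom.range_coe e.toHom).symm
  rwa [this]

theorem IsStrongMap.exists_equiv {g : A → B} (hg : K.IsStrongMap g)
    (hs : Function.Surjective g) : ∃ e : A ≃[L] B, ⇑e = g := by
  obtain ⟨e, rfl, -⟩ := hg
  exact ⟨⟨Equiv.ofBijective e ⟨e.injective, hs⟩, fun F x => e.map_fun F x,
    fun R x => e.map_rel R x⟩, rfl⟩

end StrongMap

/-- The defining property of `LS(K)` holds for every cardinal `μ ≥ LS(K)`. -/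
theorem exists_strongMap_of_LS_le {μ : Cardinal.{u}} (hLS : K.LS ≤ μ) {N : Type u}
    [L.Structure N] (hN : K.Mem N) (A : Set N) (hA : #A ≤ μ) (hμ : μ ≤ #N) :
    ∃ M : L.Substructure N, K.Strong M ∧ A ⊆ (M : Set N) ∧ #M = μ := by
  have hmem := csInf_mem (K.exists_LS : Set.Nonempty {κ : Cardinal.{u} | ℵ₀ ≤ κ ∧ L.card ≤ κ ∧
    ∀ {N : Type u} [L.Structure N], K.Mem N → ∀ A : Set N,
      ∃ M : L.Substructure N, K.Strong M ∧ A ⊆ (M : Set N) ∧ #M ≤ #A + κ})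
  obtain ⟨h1, -, h3⟩ := hmem
  -- A set of cardinality exactly `μ` is thrown in to force the lower bound on the cardinality of
  -- the submodel.
  obtain ⟨D, hD⟩ := Cardinal.le_mk_iff_exists_set.1 hμ
  have hinf : ℵ₀ ≤ μ := h1.trans hLS
  obtain ⟨M, hM, hAM, hcard⟩ := h3 hN (A ∪ D)
  refine ⟨M, hM, fun x hx => hAM (Or.inl hx), le_antisymm ?_ ?_⟩
  · refine hcard.trans ?_
    have : #↑(A ∪ D) ≤ μ := (mk_union_le A D).trans (by
      rw [hD]; exact (add_le_add_left hA _).trans (add_eq_self hinf).le)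
    exact (add_le_add this hLS).trans (add_eq_self hinf).le
  · rw [← hD]
    exact mk_le_mk_of_subset (fun x hx => hAM (Or.inr hx))

end AEC

/-! ### Models on subsets of a fixed set, their extensions and the unions of chains. -/

namespace AEC

open FirstOrder.Language

variable {L : FirstOrder.Language.{u, u}} (K : AEC L)

/-- A member of `K` whose universe is a subset of `Ω`. -/
structure SubModel (Ω : Type u) where
  carrier : Set Ω
  str : L.Structure carrier
  mem : K.Mem carrier

attribute [instance] SubModel.str

namespace SubModel

variable {K} {Ω : Type u}

/-- `M ≤_K N` for models in `Ω`. -/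
instance : Preorder (K.SubModel Ω) where
  le M N := ∃ h : M.carrier ⊆ N.carrier, K.IsStrongMap (Set.inclusion h)
  le_refl M := ⟨subset_rfl, isStrongMap_id M.mem⟩
  le_trans _ _ _ := fun ⟨h₁, h₁'⟩ ⟨h₂, h₂'⟩ => ⟨h₁.trans h₂, h₂'.comp h₁'⟩

theorem subset {M N : K.SubModel Ω} (h : M ≤ N) : M.carrier ⊆ N.carrier := h.1

theorem isStrongMap {M N : K.SubModel Ω} (h : M ≤ N) :
    K.IsStrongMap (Set.inclusion (subset h)) := h.2

theorem card_le {M N : K.SubModel Ω} (h : M ≤ N) : #M.carrier ≤ #N.carrier :=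
  mk_le_mk_of_subset (subset h)

/-- A member of `K` can be copied along an injection into `Ω`. -/
theorem exists_of_injective {B : Type u} [L.Structure B] (hB : K.Mem B) (j : B → Ω)
    (hj : Function.Injective j) :
    ∃ (N : K.SubModel Ω) (θ : B ≃[L] N.carrier), ∀ b, (θ b : Ω) = j b := by
  let : L.Structure (Set.range j) := (Equiv.ofInjective j hj).inducedStructure
  let θ : B ≃[L] Set.range j := (Equiv.ofInjective j hj).inducedStructureEquiv
  exact ⟨⟨Set.range j, inferInstance, K.mem_equiv θ hB⟩, θ, fun b => rfl⟩

theorem exists_copy {B : Type u} [L.Structure B] (hB : K.Mem B) (hc : #B ≤ #Ω) :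
    ∃ N : K.SubModel Ω, Nonempty (B ≃[L] N.carrier) := by
  obtain ⟨j⟩ := hc
  obtain ⟨N, θ, -⟩ := exists_of_injective hB j j.injective
  exact ⟨N, ⟨θ⟩⟩

/-- If there is room in `Ω`, an extension of `M` can be copied over `M` into `Ω`. -/
theorem exists_extension (M : K.SubModel Ω) {B : Type u} [L.Structure B] {g : M.carrier → B}
    (hg : K.IsStrongMap g) (hroom : #B ≤ #(M.carrierᶜ : Set Ω)) :
    ∃ (N : K.SubModel Ω) (θ : B ≃[L] N.carrier), M ≤ N ∧ ∀ x, (θ (g x) : Ω) = x := by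
  classical
  obtain ⟨i⟩ := hroom
  let j : B → Ω := fun b => if h : ∃ x, g x = b then (h.choose : Ω) else (i b : Ω)
  have hj1 : ∀ x, j (g x) = x := by
    intro x
    have h : ∃ y, g y = g x := ⟨x, rfl⟩
    simp only [j, dif_pos h]
    exact congrArg Subtype.val (hg.injective h.choose_spec)
  have hj : Function.Injective j := by
    intro b c hbc
    by_cases hb : ∃ x, g x = b <;> by_cases hc : ∃ x, g x = c
    · obtain ⟨x, rfl⟩ := hb
      obtain ⟨y, rfl⟩ := hc
      rw [hj1, hj1] at hbc
      rw [Subtype.ext hbc]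
    · obtain ⟨x, rfl⟩ := hb
      rw [hj1] at hbc
      simp only [j, dif_neg hc] at hbc
      exact absurd x.2 (by rw [hbc]; exact (i c).2)
    · obtain ⟨x, rfl⟩ := hc
      rw [hj1] at hbc
      simp only [j, dif_neg hb] at hbc
      exact absurd x.2 (by rw [← hbc]; exact (i b).2)
    · simp only [j, dif_neg hb, dif_neg hc] at hbc
      exact i.injective (Subtype.ext hbc)
  obtain ⟨N, θ, hθ⟩ := exists_of_injective hg.mem_right j hj
  have h1 : ∀ x, (θ (g x) : Ω) = x := fun x => by rw [hθ, hj1]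
  have hsub : M.carrier ⊆ N.carrier := fun x hx => by
    have := (θ (g ⟨x, hx⟩)).2
    rwa [h1] at this
  refine ⟨N, θ, ⟨hsub, ?_⟩, h1⟩
  have : Set.inclusion hsub = θ ∘ g := by
    funext x
    exact Subtype.ext (h1 x).symm
  rw [this]
  exact (isStrongMap_equiv hg.mem_right θ).comp hg

section Chain

variable {ι : Type u} [LinearOrder ι] [WellFoundedLT ι] [Nonempty ι]

/-- Smoothness. -/
theorem isStrongMap_of_iUnion {C : ι → K.SubModel Ω} (hC : Monotone C) {U : K.SubModel Ω}
    (hCU : ∀ i, C i ≤ U) (hU : U.carrier = ⋃ i, (C i).carrier) {N : Type u} [L.Structure N]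
    {g : U.carrier → N} (hg : ∀ i, K.IsStrongMap (g ∘ Set.inclusion (subset (hCU i)))) :
    K.IsStrongMap g := by
  -- Since the vocabulary is finitary, preservation of structure can be checked on finite tuples,
  -- and each of these lies in a single member of the chain.
  have htup : ∀ {n : ℕ} (x : Fin n → U.carrier), ∃ i, ∃ y : Fin n → (C i).carrier,
      x = Set.inclusion (subset (hCU i)) ∘ y := by
    intro n x
    have hx : ∀ k, ∃ i, (x k : Ω) ∈ (C i).carrier := fun k => by
      exact Set.mem_iUnion.1 (hU ▸ (x k).2)
    choose f hf using hx
    obtain ⟨i, hi⟩ := Finite.bddAbove_range f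
    refine ⟨i, fun k => ⟨x k, subset (hC (hi ⟨k, rfl⟩)) (hf k)⟩, ?_⟩
    funext k
    rfl
  choose e he he' using hg
  choose d hd hd' using fun i => isStrongMap (hCU i)
  have hcomp : ∀ i x, g (d i x) = e i x := fun i x => by rw [hd, he]; rfl
  have hcomp' : ∀ i {n : ℕ} (x : Fin n → (C i).carrier), g ∘ d i ∘ x = e i ∘ x :=
    fun i n x => funext fun k => hcomp i _
  let f : U.carrier ↪[L] N :=
    { toFun := g
      inj' := by
        intro a b hab
        obtain ⟨i, y, hy⟩ := htup ![a, b]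
        rw [← hd] at hy
        have ha : a = d i (y 0) := congrFun hy 0
        have hb : b = d i (y 1) := congrFun hy 1
        rw [ha, hb, hcomp, hcomp] at hab
        rw [ha, hb, (e i).injective hab]
      map_fun' := by
        intro n F x
        obtain ⟨i, y, rfl⟩ := htup x
        rw [← hd, ← (d i).map_fun, hcomp, hcomp', (e i).map_fun]
      map_rel' := by
        intro n R x
        obtain ⟨i, y, rfl⟩ := htup x
        rw [← hd, hcomp', (d i).map_rel, (e i).map_rel] }
  refine ⟨f, rfl, ?_⟩
  have hrange : f.toHom.range = ⨆ i, (e i).toHom.range := by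
    apply le_antisymm
    · rintro _ ⟨x, rfl⟩
      obtain ⟨i, hi⟩ := Set.mem_iUnion.1 (hU ▸ x.2 : (x : Ω) ∈ ⋃ i, (C i).carrier)
      refine (le_iSup (fun i => (e i).toHom.range) i) ⟨⟨x, hi⟩, ?_⟩
      exact (hcomp i _).symm.trans (by rw [hd]; rfl)
    · refine iSup_le fun i => ?_
      rintro _ ⟨x, rfl⟩
      exact ⟨d i x, hcomp i x⟩
  rw [IsEmb, hrange]
  refine K.strong_iSup _ ?_ he'
  rintro i j hij _ ⟨x, rfl⟩
  refine ⟨Set.inclusion (subset (hC hij)) x, ?_⟩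
  exact (congrFun (he j) _).trans (congrFun (he i) x).symm

/-- The union of a well-ordered chain of models in `Ω`. -/
theorem exists_iUnion {C : ι → K.SubModel Ω} (hC : Monotone C) :
    ∃ U : K.SubModel Ω, (∀ i, C i ≤ U) ∧ U.carrier = ⋃ i, (C i).carrier := by
  choose d hd hd' using fun (i j : ι) (h : i ≤ j) => isStrongMap (hC h)
  let G : ι → Type u := fun i => (C i).carrier
  have hdv : ∀ i j h (x : G i), (d i j h x : Ω) = x := fun i j h x => by rw [hd]
  have : DirectedSystem G fun i j h => d i j h :=
    { map_self := fun i x => Subtype.ext (hdv _ _ _ _)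
      map_map := fun k j i hij hjk x => Subtype.ext (by rw [hdv, hdv, hdv]) }
  -- The union gets its structure by transport from the direct limit, along the map `j` that sends a
  -- class to the common value of its representatives in `Ω`.
  let D := FirstOrder.Language.DirectLimit G d
  let o : ∀ i, G i ↪[L] D := FirstOrder.Language.DirectLimit.of L ι G d
  have ho : ∀ i j (h : i ≤ j) x, o j (d i j h x) = o i x := fun i j h x =>
    FirstOrder.Language.DirectLimit.of_f
  have hex : ∀ z : D, ∃ i x, o i x = z := FirstOrder.Language.DirectLimit.exists_of
  choose k y hy using hex
  let j : D → Ω := fun z => y z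
  have hjo : ∀ i x, j (o i x) = x := by
    intro i x
    have h1 : o (max i (k (o i x))) (d _ _ (le_max_right _ _) (y (o i x))) =
        o (max i (k (o i x))) (d _ _ (le_max_left _ _) x) := by rw [ho, ho, hy]
    have h2 := congrArg Subtype.val ((o _).injective h1)
    rw [hdv, hdv] at h2
    exact h2
  have hj : Function.Injective j := by
    intro a b hab
    set m := max (k a) (k b)
    rw [← hy a, ← hy b, ← ho _ m (le_max_left _ _), ← ho _ m (le_max_right _ _)]
    congr 1
    apply Subtype.ext
    rw [hdv, hdv]
    exact hab
  have hmono : Monotone fun i => (o i).toHom.range := by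
    rintro i j h _ ⟨x, rfl⟩
    exact ⟨d i j h x, ho i j h x⟩
  have hstr : ∀ i, K.Strong (o i).toHom.range := by
    refine K.strong_chain _ hmono ?_ FirstOrder.Language.DirectLimit.iSup_range_of_eq_top
    intro i j h
    have hoj : K.IsStrongMap (o j).equivRange := isStrongMap_equiv (C j).mem _
    have hij : K.IsStrongMap (d i j h) := (hd' i j h).isStrongMap
    refine (hoj.comp hij).strong_range ?_
    ext z
    constructor
    · rintro ⟨x, hx⟩
      exact ⟨x, Subtype.ext ((ho i j h x).trans hx)⟩
    · rintro ⟨x, rfl⟩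
      exact ⟨x, (ho i j h x).symm⟩
  have ho' : ∀ i, K.IsStrongMap (o i) := fun i => IsEmb.isStrongMap (hstr i)
  obtain ⟨i₀⟩ := ‹Nonempty ι›
  obtain ⟨U, θ, hθ⟩ := exists_of_injective (ho' i₀).mem_right j hj
  have hθo : ∀ i x, (θ (o i x) : Ω) = x := fun i x => by rw [hθ, hjo]
  have hsub : ∀ i, (C i).carrier ⊆ U.carrier := fun i x hx => by
    have := (θ (o i ⟨x, hx⟩)).2
    rwa [hθo] at this
  refine ⟨U, fun i => ⟨hsub i, ?_⟩, ?_⟩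
  · have : Set.inclusion (hsub i) = θ ∘ o i := by
      funext x
      exact Subtype.ext (hθo i x).symm
    rw [this]
    exact (isStrongMap_equiv (ho' i).mem_right θ).comp (ho' i)
  · apply Set.Subset.antisymm
    · intro x hx
      obtain ⟨z, hz⟩ := θ.surjective ⟨x, hx⟩
      have : j z = x := by rw [← hθ, hz]
      rw [← this]
      exact Set.mem_iUnion.2 ⟨k z, (y z).2⟩
    · exact Set.iUnion_subset hsub

end Chain

end SubModel

end AEC

/-! ### Transfinite recursion along a binary tree. -/

namespace AEC

/-- Recursion along all branches of a binary tree of length `ι`, with continuous limits. -/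
theorem exists_tree {ι : Type*} [LinearOrder ι] [WellFoundedLT ι] {T : Type*} [Preorder T]
    (P : T → Prop) (Q : Set T → T → Prop) {base : T} (hbase : P base)
    (hU : ∀ (α : ι) (C : Set.Iio α → T), Nonempty (Set.Iio α) → Monotone C → (∀ β, P (C β)) →
      ∃ t, P t ∧ (∀ β, C β ≤ t) ∧ Q (Set.range C) t)
    (G : ι → T → Bool → T) (hG : ∀ α t b, P t → t ≤ G α t b ∧ P (G α t b)) :
    ∃ M : (ι → Bool) → ι → T,
      (∀ η α, P (M η α)) ∧ (∀ η α, base ≤ M η α) ∧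
      (∀ η α β, β < α → G β (M η β) (η β) ≤ M η α) ∧
      (∀ η ν α, (∀ β < α, η β = ν β) → M η α = M ν α) ∧
      (∀ η α, Nonempty (Set.Iio α) →
        Q (Set.range fun β : Set.Iio α => G β (M η β) (η β)) (M η α)) ∧
      (∀ η α, ¬ Nonempty (Set.Iio α) → M η α = base) := by
  classical
  let Good : ∀ α : ι, (Set.Iio α → T) → T → Prop := fun α C t =>
    P t ∧ (∀ β, C β ≤ t) ∧ Q (Set.range C) t
  -- Bounds are taken of the chosen successors `G β (M η β) (η β)` for `β < α`, not of the nodes, so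
  -- successor and limit stages need no separate treatment. The default `base` is the value at the
  -- first node.
  let U : ∀ α : ι, (Set.Iio α → T) → T := fun α C =>
    if h : Nonempty (Set.Iio α) ∧ ∃ t, Good α C t then h.2.choose else base
  let M : (ι → Bool) → ι → T := fun η => (wellFounded_lt (α := ι)).fix fun α ih =>
    U α fun β => G β (ih β β.2) (η β)
  have hM : ∀ η α, M η α = U α fun β => G β (M η β) (η β) := fun η α =>
    WellFounded.fix_eq _ _ _
  have hempty : ∀ η α, ¬ Nonempty (Set.Iio α) → M η α = base := fun η α h => by
    rw [hM]
    exact dif_neg fun h' => h h'.1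
  have key : ∀ η α, P (M η α) ∧ base ≤ M η α ∧
      (∀ β < α, G β (M η β) (η β) ≤ M η α) ∧
      (Nonempty (Set.Iio α) →
        Q (Set.range fun β : Set.Iio α => G β (M η β) (η β)) (M η α)) := by
    intro η α
    induction α using (wellFounded_lt (α := ι)).induction with
    | _ α ih =>
    by_cases hne : Nonempty (Set.Iio α)
    · have hmono : Monotone fun β : Set.Iio α => G β (M η β) (η β) := by
        intro β γ hβγ
        rcases hβγ.eq_or_lt with rfl | hlt
        · exact le_rfl
        · exact ((ih γ γ.2).2.2.1 β hlt).trans (hG _ _ _ (ih γ γ.2).1).1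
      have hex := hU α _ hne hmono fun β => (hG β _ (η β) (ih β β.2).1).2
      have hgood : Good α (fun β => G β (M η β) (η β)) (M η α) := by
        rw [hM]
        have : U α (fun β => G β (M η β) (η β)) = hex.choose := dif_pos ⟨hne, hex⟩
        rw [this]
        exact hex.choose_spec
      refine ⟨hgood.1, ?_, fun β hβ => hgood.2.1 ⟨β, hβ⟩, fun _ => hgood.2.2⟩
      obtain ⟨β⟩ := hne
      exact ((ih β β.2).2.1.trans (hG _ _ _ (ih β β.2).1).1).trans (hgood.2.1 β)
    · rw [hempty η α hne]
      exact ⟨hbase, le_rfl, fun β hβ => absurd ⟨⟨β, hβ⟩⟩ hne, fun h => absurd h hne⟩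
  refine ⟨M, fun η α => (key η α).1, fun η α => (key η α).2.1,
    fun η α β h => (key η α).2.2.1 β h, ?_, fun η α => (key η α).2.2.2, hempty⟩
  intro η ν α
  induction α using (wellFounded_lt (α := ι)).induction with
  | _ α ih =>
  intro h
  rw [hM, hM]
  congr 1
  funext β
  rw [ih β β.2 fun γ hγ => h γ (hγ.trans β.2), h β β.2]

/-! ### Weak diamond: the ideal of small sets, disjoint large sets, and guessing of filtrations. -/

section WeakDiamond

variable {ι : Type u} [LinearOrder ι]

/-- The sets `S` on which weak diamond fails: every `g : S → Bool` can be predicted by a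
function of the restrictions of some `f`. -/
def WeakDiamondSmall (μ : Cardinal.{u}) (S : Set ι) : Prop :=
  ∃ X : Type u, #X ≤ 2 ^ μ ∧ ∃ F : ∀ δ : ι, X → (Set.Iio δ → X) → Bool,
    ∀ g : ι → Bool, ∃ (x : X) (f : ι → X), ∀ δ ∈ S, F δ x (fun β => f β) = g δ

variable {μ : Cardinal.{u}}

theorem WeakDiamondSmall.mono {S S' : Set ι} (h : S ⊆ S') (hS : WeakDiamondSmall μ S') :
    WeakDiamondSmall μ S := by
  obtain ⟨X, hX, F, hF⟩ := hS
  refine ⟨X, hX, F, fun g => ?_⟩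
  obtain ⟨x, f, hf⟩ := hF g
  exact ⟨x, f, fun δ hδ => hf δ (h hδ)⟩

/-- The parameter `x` alone can store all values of `g` on `S`, as there are at most `2 ^ μ`
possibilities. -/
theorem weakDiamondSmall_of_card_le {S : Set ι} (hS : #S ≤ μ) : WeakDiamondSmall μ S := by
  classical
  refine ⟨S → Bool, ?_, fun δ x _ => if h : δ ∈ S then x ⟨δ, h⟩ else false, fun g =>
    ⟨fun s => g s, fun _ _ => false, fun δ hδ => dif_pos hδ⟩⟩
  simpa using power_le_power_left two_ne_zero hS

/-- The codes for the individual sets are run in parallel: a product of at most `μ` code sets still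
has at most `2 ^ μ` elements, and `δ` is decoded in a coordinate `b` with `δ ∈ S b`. -/
theorem WeakDiamondSmall.iUnion {B : Type u} (hμ : ℵ₀ ≤ μ) (hB : #B ≤ μ) {S : B → Set ι}
    (hS : ∀ b, WeakDiamondSmall μ (S b)) : WeakDiamondSmall μ (⋃ b, S b) := by
  classical
  choose X hX F hF using hS
  refine ⟨∀ b, X b, ?_, fun δ x f => if h : ∃ b, δ ∈ S b then
    F h.choose δ (x h.choose) (fun β => f β h.choose) else false, fun g => ?_⟩
  · rw [mk_pi]
    calc prod (fun b => #(X b)) ≤ prod fun _ : B => (2 : Cardinal.{u}) ^ μ := prod_le_prod _ _ hX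
      _ = (2 ^ μ) ^ #B := by rw [prod_const, lift_id, lift_id]
      _ ≤ (2 ^ μ) ^ μ := power_le_power_left (power_ne_zero μ two_ne_zero) hB
      _ = 2 ^ μ := by rw [← power_mul, mul_eq_self hμ]
  · choose x f hf using fun b => hF b g
    refine ⟨x, fun δ b => f b δ, fun δ hδ => ?_⟩
    have h : ∃ b, δ ∈ S b := Set.mem_iUnion.1 hδ
    refine (dif_pos h).trans ?_
    exact hf _ _ h.choose_spec

theorem WeakDiamondSmall.union (hμ : ℵ₀ ≤ μ) {S S' : Set ι} (hS : WeakDiamondSmall μ S)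
    (hS' : WeakDiamondSmall μ S') : WeakDiamondSmall μ (S ∪ S') := by
  have h := WeakDiamondSmall.iUnion (B := ULift.{u} Bool) (S := fun b => cond b.down S S') hμ
    ((lt_aleph0_of_finite _).le.trans hμ) (by rintro ⟨_ | _⟩ <;> assumption)
  refine h.mono ?_
  rintro x (hx | hx)
  · exact Set.mem_iUnion.2 ⟨⟨true⟩, hx⟩
  · exact Set.mem_iUnion.2 ⟨⟨false⟩, hx⟩

/-- The Devlin–Shelah theorem. -/
theorem not_weakDiamondSmall_univ [WellFoundedLT ι] (hμ : ℵ₀ ≤ μ)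
    (h : (2 : Cardinal.{u}) ^ μ < 2 ^ #ι) : ¬ WeakDiamondSmall μ (Set.univ : Set ι) := by
  rintro ⟨X, hX, F, hF⟩
  obtain ⟨B, rfl⟩ : ∃ B : Type u, #B = μ := ⟨_, mk_out μ⟩
  have hX2 : #(B → Bool) = 2 ^ #B := by simp
  have hBX : #(B → X) ≤ #(B → Bool) := by
    rw [hX2, ← power_def]
    calc #X ^ #B ≤ (2 ^ #B) ^ #B := power_le_power_right hX
      _ = 2 ^ #B := by rw [← power_mul, mul_eq_self hμ]
  obtain ⟨e⟩ := hBX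
  have hX0 : Nonempty X := ⟨(hF fun _ => false).choose⟩
  have he := Function.leftInverse_invFun e.injective
  set d := Function.invFun e
  -- Predicting each of the `μ` coordinates separately and packing the results through `e` makes the
  -- predicted functions and the codes objects of the same kind, so that coding can be iterated.
  have hpred : ∀ g : ι → B → Bool, ∃ (x : B → Bool) (f : ι → B → Bool), ∀ δ,
      (fun b => F δ (d x b) fun β => d (f β) b) = g δ := by
    intro g
    choose x f hf using fun b => hF fun δ => g δ b
    refine ⟨e x, fun δ => e fun b => f b δ, fun δ => funext fun b => ?_⟩
    simp only [he _]
    exact hf b δ trivial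
  choose x f hf using hpred
  -- Each iterate is computed at `δ` from its parameter `x` and from the next iterate below `δ`. By
  -- induction on `δ`, for all `n` at once, the countably many parameters determine `g`, so there
  -- are at most `(2 ^ μ) ^ ℵ₀ = 2 ^ μ` functions `g`.
  let s : (ι → B → Bool) → ℕ → ι → B → Bool := fun g n => f^[n] g
  have hs : ∀ g n, s g (n + 1) = f (s g n) := fun g n => Function.iterate_succ_apply' f n g
  have hinj : Function.Injective fun (g : ι → B → Bool) (n : ℕ) => x (s g n) := by
    intro g g' hgg
    have hx : ∀ n, x (s g n) = x (s g' n) := fun n => congrFun hgg n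
    have : ∀ δ n, s g n δ = s g' n δ := by
      intro δ
      induction δ using (wellFounded_lt (α := ι)).induction with
      | _ δ ih =>
      intro n
      rw [← hf (s g n) δ, ← hf (s g' n) δ, hx n, ← hs, ← hs]
      funext b
      congr 1
      funext β
      rw [ih β β.2]
    exact funext fun δ => this δ 0
  refine absurd h (not_lt.2 ?_)
  have hι : (2 : Cardinal.{u}) ^ #ι ≤ #(ι → B → Bool) := by
    rw [← power_def, hX2]
    exact power_le_power_right (by
      simpa using power_le_power_left (two_ne_zero (α := Cardinal.{u})) (one_le_aleph0.trans hμ))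
  have hN : #(ℕ → B → Bool) = 2 ^ #B := by
    simp only [mk_pi, prod_const, mk_bool, lift_uzero, mk_nat, lift_aleph0]
    rw [lift_two, ← power_mul, mul_aleph0_eq hμ]
  exact hι.trans ((mk_le_of_injective hinj).trans hN.le)

/-- There are `#ι` disjoint sets on which weak diamond holds. -/
theorem exists_disjoint_not_weakDiamondSmall [WellFoundedLT ι] (hμ : ℵ₀ ≤ μ) (hι : #ι = Order.succ μ)
    (h : (2 : Cardinal.{u}) ^ μ < 2 ^ Order.succ μ) (hIio : ∀ α : ι, #(Set.Iio α) ≤ μ) :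
    ∃ S : ι → Set ι, (∀ i, ¬ WeakDiamondSmall μ (S i)) ∧ Pairwise fun i j => Disjoint (S i) (S j) := by
  obtain ⟨B, rfl⟩ : ∃ B : Type u, #B = μ := ⟨_, mk_out μ⟩
  have hex : ∀ α : ι, ∃ e : Set.Iio α → B, Function.Injective e := fun α => by
    obtain ⟨e⟩ := hIio α
    exact ⟨e, e.injective⟩
  choose e he using hex
  -- An Ulam matrix. Each row covers everything above `α`, so by completeness of the ideal some
  -- entry in it is large; each column consists of disjoint sets, since every `e β` is injective.
  let A : ι → B → Set ι := fun α b => {β | ∃ hαβ : α < β, e β ⟨α, hαβ⟩ = b}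
  have hA : ∀ α, ∃ b, ¬ WeakDiamondSmall #B (A α b) := by
    intro α
    by_contra! hcon
    refine not_weakDiamondSmall_univ (ι := ι) hμ (by rwa [hι]) ?_
    refine WeakDiamondSmall.mono ?_ ((WeakDiamondSmall.iUnion hμ le_rfl hcon).union hμ
      (weakDiamondSmall_of_card_le (S := Set.Iic α) ?_))
    · intro β _
      rcases lt_or_ge α β with hlt | hle
      · exact Or.inl (Set.mem_iUnion.2 ⟨_, hlt, rfl⟩)
      · exact Or.inr hle
    · rw [← Set.Iio_insert]
      exact mk_insert_le.trans (by
        exact (add_le_add (hIio α) (one_le_aleph0.trans hμ)).trans (add_eq_self hμ).le)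
  choose b hb using hA
  -- By regularity of `μ⁺`, a single column contains `μ⁺` of the large entries.
  obtain ⟨b₀, hb₀⟩ := infinite_pigeonhole_card b (Order.succ #B) hι.ge
    (hμ.trans (Order.le_succ _)) (by rw [(isRegular_succ hμ).cof_ord]; exact Order.lt_succ _)
  rw [← hι] at hb₀
  obtain ⟨φ⟩ := hb₀
  refine ⟨fun i => A (φ i) b₀, fun i => ?_, fun i j hij => ?_⟩
  · have := hb (φ i)
    rwa [show b (φ i) = b₀ from (φ i).2] at this
  · refine Set.disjoint_left.2 ?_
    rintro β ⟨h1, h1'⟩ ⟨h2, h2'⟩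
    have := congrArg Subtype.val (he β (h1'.trans h2'.symm))
    exact hij (φ.injective (Subtype.ext this))

/-- Weak diamond on `S`, for continuous filtrations of subsets of `Z` and closed unbounded sets. -/
theorem exists_guess (hμ : ℵ₀ ≤ μ) (hι : #ι ≤ 2 ^ μ) (hIio : ∀ α : ι, #(Set.Iio α) ≤ μ)
    {S : Set ι} (hS : ¬ WeakDiamondSmall μ S) {Z : Type u} (hZ : #Z ≤ 2 ^ μ)
    (F : ι → Set Z → Bool) :
    ∃ g : ι → Bool, ∀ (A : ι → Set Z) (C : Set ι), Monotone A → (∀ α, #(A α) ≤ μ) →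
      (∀ δ, ∀ z ∈ A δ, (∀ γ, z ∈ A γ) ∨ ∃ β < δ, ∀ γ, β < γ → z ∈ A γ) →
      (∀ α, ∃ c ∈ C, α < c) →
      (∀ δ, (∃ c ∈ C, c ≤ δ) → (∀ α < δ, ∃ c ∈ C, α < c ∧ c ≤ δ) → δ ∈ C) →
      ∃ δ ∈ S, δ ∈ C ∧ F δ (A δ) = g δ := by
  classical
  by_contra! hcon
  have hpow : ((2 : Cardinal.{u}) ^ μ) ^ μ = 2 ^ μ := by rw [← power_mul, mul_eq_self hμ]
  have h2 : ℵ₀ ≤ (2 : Cardinal.{u}) ^ μ := hμ.trans (cantor μ).le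
  have hbdd : ∀ {Y : Type u}, #Y ≤ 2 ^ μ → #{t : Set Y // #t ≤ μ} ≤ 2 ^ μ := fun {Y} hY =>
    (mk_bounded_set_le Y μ).trans ((power_le_power_right (max_le hY h2)).trans hpow.le)
  -- If no `g` guesses, each `g` can be recovered from a counterexample `A`, `C`. A code records,
  -- for some `c ∈ C`, the set `A c`, the values of `g` below `c`, and `c`. If an available code has
  -- `c > δ`, then `g δ` is read off. Otherwise `δ` is a limit of `C`, the codes add up to `A δ`,
  -- and `g δ` is the negation of `F δ (A δ)`.
  refine hS ⟨{t : Set Z // #t ≤ μ} × {t : Set ι // #t ≤ μ} × ι, ?_, fun δ x D =>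
    if δ < x.2.2 then decide (δ ∈ x.2.1.1)
    else if h : ∃ α, δ < (D α).2.2 then decide (δ ∈ (D h.choose).2.1.1)
    else ! F δ (x.1.1 ∪ ⋃ α, (D α).1.1), fun g => ?_⟩
  · rw [← mul_def, ← mul_def]
    exact (mul_le_mul' (hbdd hZ) ((mul_le_mul' (hbdd hι) hι).trans (mul_eq_self h2).le)).trans
      (mul_eq_self h2).le
  · obtain ⟨A, C, hA, hAcard, hcont, hunb, hcl, hne⟩ := hcon g
    have hSne : Nonempty ι := by
      by_contra h
      exact hS (weakDiamondSmall_of_card_le (by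
        rw [not_nonempty_iff] at h
        rw [mk_eq_zero]
        exact zero_le))
    obtain ⟨ι₀⟩ := hSne
    obtain ⟨c₀, hc₀, -⟩ := hunb ι₀
    choose γ hγC hγ using hunb
    let D : ι → {t : Set Z // #t ≤ μ} × {t : Set ι // #t ≤ μ} × ι := fun c =>
      ⟨⟨A c, hAcard c⟩, ⟨{β | β < c ∧ g β = true},
        (mk_le_mk_of_subset fun β h => h.1).trans (hIio c)⟩, c⟩
    have hbit : ∀ δ c, δ < c → ∀ _ : Decidable (δ ∈ (D c).2.1.1),
        decide (δ ∈ (D c).2.1.1) = g δ := by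
      intro δ c h _
      have : δ ∈ (D c).2.1.1 ↔ g δ = true := ⟨fun h => h.2, fun h' => ⟨h, h'⟩⟩
      simp [this]
    refine ⟨D c₀, fun α => D (γ α), fun δ hδ => ?_⟩
    by_cases h1 : δ < c₀
    · exact (if_pos h1).trans (hbit δ c₀ h1 _)
    refine (if_neg h1).trans ?_
    by_cases h3 : ∃ α : Set.Iio δ, δ < (D (γ α)).2.2
    · exact (dif_pos h3).trans (hbit δ _ h3.choose_spec _)
    refine (dif_neg h3).trans ?_
    push Not at h1 h3
    have h4 : ∀ α < δ, γ α ≤ δ := fun α hα => h3 ⟨α, hα⟩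
    have hδC : δ ∈ C := hcl δ ⟨c₀, hc₀, h1⟩ fun α hα => ⟨γ α, hγC α, hγ α, h4 α hα⟩
    have hAδ : A c₀ ∪ ⋃ α : Set.Iio δ, A (γ α) = A δ := by
      apply Set.Subset.antisymm
      · exact Set.union_subset (hA h1) (Set.iUnion_subset fun α => hA (h4 α α.2))
      · intro z hz
        rcases hcont δ z hz with h | ⟨β, hβ, h⟩
        · exact Or.inl (h c₀)
        · exact Or.inr (Set.mem_iUnion.2 ⟨⟨β, hβ⟩, h _ (hγ β)⟩)
    change (! F δ (A c₀ ∪ ⋃ α : Set.Iio δ, A (γ α))) = g δ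
    rw [hAδ]
    have := hne δ hδ hδC
    revert this
    generalize F δ (A δ) = a, g δ = b
    revert a b
    decide

end WeakDiamond

end AEC

/-! ### Categoricity, amalgamation, and trees of models of cardinality `μ`. -/

namespace AEC

open FirstOrder.Language

variable {L : FirstOrder.Language.{u, u}} (K : AEC L)

/-- Categoricity in `μ`. -/
def Categorical (μ : Cardinal.{u}) : Prop :=
  ∀ (M N : Type u) [L.Structure M] [L.Structure N], K.Mem M → K.Mem N → #M = μ → #N = μ →
    Nonempty (M ≃[L] N)

/-- Two maps from `A` can be completed to a commutative square of `K`-embeddings. -/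
def Amalgamable {A B C : Type u} [L.Structure B] [L.Structure C]
    (f : A → B) (g : A → C) : Prop :=
  ∃ (R : Type u) (_ : L.Structure R) (f' : B → R) (g' : C → R),
    K.IsStrongMap f' ∧ K.IsStrongMap g' ∧ ∀ x, f' (f x) = g' (g x)

/-- The amalgamation property in `μ`. -/
def AmalgamationProperty (μ : Cardinal.{u}) : Prop :=
  ∀ (A B C : Type u) [L.Structure A] [L.Structure B] [L.Structure C] (f : A → B) (g : A → C),
    #A = μ → #B = μ → #C = μ → K.IsStrongMap f → K.IsStrongMap g → K.Amalgamable f g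

variable {K} {μ : Cardinal.{u}}

theorem Amalgamable.comp {A' A B C : Type u} [L.Structure B] [L.Structure C]
    {f : A → B} {g : A → C} (h : K.Amalgamable f g) (k : A' → A) :
    K.Amalgamable (f ∘ k) (g ∘ k) := by
  obtain ⟨R, _, f', g', hf, hg, hfg⟩ := h
  exact ⟨R, _, f', g', hf, hg, fun x => hfg _⟩

/-- Two strong maps of models of cardinality at most `μ` factor through a strong submodel of
cardinality `μ` that contains a prescribed set. -/
theorem exists_factor_card (hLS : K.LS ≤ μ) (hμ : ℵ₀ ≤ μ) {B C R : Type u} [L.Structure B]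
    [L.Structure C] [L.Structure R] {f : B → R} {g : C → R} (hf : K.IsStrongMap f)
    (hg : K.IsStrongMap g) (hB : #B ≤ μ) (hC : #C ≤ μ) (hR : μ ≤ #R) (D : Set R) (hD : #D ≤ μ) :
    ∃ (R' : Type u) (_ : L.Structure R') (i : R' → R) (f' : B → R') (g' : C → R'), #R' = μ ∧
      K.IsStrongMap i ∧ K.IsStrongMap f' ∧ K.IsStrongMap g' ∧ i ∘ f' = f ∧ i ∘ g' = g ∧
      D ⊆ Set.range i := by
  obtain ⟨S, hS, hsub, hcard⟩ := K.exists_strongMap_of_LS_le hLS hf.mem_right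
    (Set.range f ∪ Set.range g ∪ D) (by
      refine (mk_union_le _ _).trans ((add_le_add ((mk_union_le _ _).trans
        (add_le_add (mk_range_le.trans hB) (mk_range_le.trans hC))) hD).trans ?_)
      rw [add_eq_self hμ, add_eq_self hμ]) hR
  have hi := isStrongMap_subtype hS
  have hf' : (Subtype.val : S → R) ∘ (fun b => ⟨f b, hsub (Or.inl (Or.inl ⟨b, rfl⟩))⟩) = f := rfl
  have hg' : (Subtype.val : S → R) ∘ (fun b => ⟨g b, hsub (Or.inl (Or.inr ⟨b, rfl⟩))⟩) = g := rfl
  refine ⟨S, inferInstance, Subtype.val, _, _, hcard, hi, IsStrongMap.of_comp hi (by rwa [hf']),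
    IsStrongMap.of_comp hi (by rwa [hg']), hf', hg', ?_⟩
  intro x hx
  exact ⟨⟨x, hsub (Or.inr hx)⟩, rfl⟩

namespace SubModel

variable {Ω : Type u}

/-- `N₀` and `N₁` can be amalgamated over `M`. -/
def AmalgOver (M N₀ N₁ : K.SubModel Ω) : Prop :=
  ∃ (R : Type u) (_ : L.Structure R) (g₀ : N₀.carrier → R) (g₁ : N₁.carrier → R),
    K.IsStrongMap g₀ ∧ K.IsStrongMap g₁ ∧
      ∀ x (h₀ : x ∈ N₀.carrier) (h₁ : x ∈ N₁.carrier), x ∈ M.carrier → g₀ ⟨x, h₀⟩ = g₁ ⟨x, h₁⟩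

theorem AmalgOver.symm {M N₀ N₁ : K.SubModel Ω} (h : AmalgOver M N₀ N₁) : AmalgOver M N₁ N₀ := by
  obtain ⟨R, _, g₀, g₁, h₀, h₁, h⟩ := h
  exact ⟨R, _, g₁, g₀, h₁, h₀, fun x hx hx' hM => (h x hx' hx hM).symm⟩

theorem mem_of_le {M N : K.SubModel Ω} (h : M ≤ N) {x : Ω} (hx : x ∈ M.carrier) :
    x ∈ N.carrier := subset h hx

/-- A trivial extension amalgamates with anything, so incompatible successors are proper and
branches reach cardinality `μ⁺`. -/
theorem not_subset_of_not_amalgOver {M N₀ N₁ : K.SubModel Ω} (h₀ : M ≤ N₀) (h₁ : M ≤ N₁)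
    (h : ¬ AmalgOver M N₀ N₁) : ¬ N₀.carrier ⊆ M.carrier := by
  intro hsub
  have hsurj : Function.Surjective (Set.inclusion (subset h₀)) := fun x => ⟨⟨x, hsub x.2⟩, rfl⟩
  obtain ⟨e, he⟩ := (isStrongMap h₀).exists_equiv hsurj
  refine h ⟨N₁.carrier, inferInstance, Set.inclusion (subset h₁) ∘ e.symm, id,
    (isStrongMap h₁).comp (isStrongMap_equiv N₀.mem _), isStrongMap_id N₁.mem, ?_⟩
  intro x hx₀ hx₁ hM
  have : e.symm ⟨x, hx₀⟩ = ⟨x, hM⟩ := by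
    apply e.injective
    rw [e.apply_symm_apply, he]
  simp only [Function.comp_apply, this]
  rfl

theorem card_compl {ι : Type u} (hμ : ℵ₀ ≤ μ) (hι : #ι = Order.succ μ) (M : K.SubModel ι)
    (hM : #M.carrier ≤ μ) : #(M.carrierᶜ : Set ι) = Order.succ μ := by
  have h : #M.carrier < #ι := by rw [hι]; exact Order.lt_succ_of_le hM
  have : Infinite ι := by
    rw [infinite_iff, hι]
    exact hμ.trans (Order.le_succ _)
  rw [mk_compl_of_infinite _ h, hι]

/-- Copies over `M` of two extensions. -/
theorem exists_extension_of_card {ι : Type u} (hμ : ℵ₀ ≤ μ) (hι : #ι = Order.succ μ)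
    (M : K.SubModel ι) (hM : #M.carrier ≤ μ) {B : Type u} [L.Structure B] {g : M.carrier → B}
    (hg : K.IsStrongMap g) (hB : #B ≤ μ) :
    ∃ (N : K.SubModel ι) (θ : B ≃[L] N.carrier), M ≤ N ∧ ∀ x, (θ (g x) : ι) = x :=
  M.exists_extension hg (by
    rw [card_compl hμ hι M hM]
    exact hB.trans (Order.le_succ _))

section Tree

variable {ι : Type u} [LinearOrder ι] [WellFoundedLT ι]

theorem card_iUnion_le {κ : Cardinal.{u}} (hκ : ℵ₀ ≤ κ) {I : Type u} (hI : #I ≤ κ) {α : Type u}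
    {s : I → Set α} (hs : ∀ i, #(s i) ≤ κ) : #(⋃ i, s i) ≤ κ := by
  refine mk_iUnion_le_sum_mk.trans ((sum_le_sum _ (fun _ => κ) hs).trans ?_)
  rw [sum_const, lift_id, lift_id]
  exact (mul_le_mul' hI le_rfl).trans (mul_eq_self hκ).le

/-- A point chosen from `t i \ s i` is new at stage `i`, hence different stages yield different
points. -/
theorem card_le_of_strictly_increasing {I α : Type u} [LinearOrder I] {s t : I → Set α}
    {U : Set α} (hst : ∀ i, ¬ t i ⊆ s i) (hts : ∀ i j, i < j → t i ⊆ s j) (hU : ∀ i, t i ⊆ U) :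
    #I ≤ #U := by
  choose x hx hx' using fun i => Set.not_subset.1 (hst i)
  refine mk_le_of_injective (f := fun i => (⟨x i, hU i (hx i)⟩ : U)) ?_
  have hlt : ∀ i j, i < j → x i ≠ x j := fun i j h heq => hx' j (heq ▸ hts i j h (hx i))
  intro i j h
  have h' : x i = x j := congrArg Subtype.val h
  rcases lt_trichotomy i j with h1 | h1 | h1
  · exact absurd h' (hlt _ _ h1)
  · exact h1
  · exact absurd h'.symm (hlt _ _ h1)

/-- A binary tree of models of cardinality `μ`, and the models along its branches. -/
theorem exists_modelTree (hμ : ℵ₀ ≤ μ) (hι : #ι = Order.succ μ) (hIio : ∀ α : ι, #(Set.Iio α) ≤ μ)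
    {base : K.SubModel ι} (hbase : #base.carrier = μ) (G : K.SubModel ι → Bool → K.SubModel ι)
    (hG : ∀ M b, #M.carrier = μ → base ≤ M →
      M ≤ G M b ∧ #(G M b).carrier = μ ∧ ¬ (G M b).carrier ⊆ M.carrier) :
    ∃ (M : (ι → Bool) → ι → K.SubModel ι) (U : (ι → Bool) → K.SubModel ι),
      (∀ η α, #(M η α).carrier = μ ∧ base ≤ M η α) ∧
      (∀ η α β, β < α → G (M η β) (η β) ≤ M η α) ∧
      (∀ η ν α, (∀ β < α, η β = ν β) → M η α = M ν α) ∧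
      (∀ η α, ∀ x ∈ (M η α).carrier, x ∈ base.carrier ∨
        ∃ β < α, x ∈ (G (M η β) (η β)).carrier) ∧
      (∀ η α, G (M η α) (η α) ≤ U η) ∧
      (∀ η, ∀ x ∈ (U η).carrier, ∃ α, x ∈ (G (M η α) (η α)).carrier) ∧
      (∀ η, #(U η).carrier = Order.succ μ) := by
  let P : K.SubModel ι → Prop := fun M => #M.carrier = μ ∧ base ≤ M
  -- Continuity: a node contains nothing beyond what the earlier stages supply. The reverse
  -- inclusion is part of being an upper bound.
  let Q : Set (K.SubModel ι) → K.SubModel ι → Prop := fun S t =>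
    t.carrier ⊆ ⋃ s ∈ S, s.carrier
  have hPG : ∀ (α : ι) t b, P t → t ≤ G t b ∧ P (G t b) := fun _ t b ht =>
    ⟨(hG t b ht.1 ht.2).1, (hG t b ht.1 ht.2).2.1, ht.2.trans (hG t b ht.1 ht.2).1⟩
  obtain ⟨M, hM1, hM2, hM3, hM4, hM5, hM6⟩ := exists_tree P Q (base := base) ⟨hbase, le_rfl⟩ (by
    intro α C hne hC hP
    obtain ⟨t, ht, htc⟩ := exists_iUnion hC
    obtain ⟨β⟩ := hne
    refine ⟨t, ⟨le_antisymm ?_ ?_, (hP β).2.trans (ht β)⟩, ht, ?_⟩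
    · rw [htc]
      exact card_iUnion_le hμ (hIio α) fun β => (hP β).1.le
    · rw [← (hP β).1]
      exact card_le (ht β)
    · intro x hx
      rw [htc] at hx
      simpa using hx) (fun _ => G) hPG
  have hmono : ∀ η, Monotone fun α => G (M η α) (η α) := by
    intro η α β hαβ
    rcases hαβ.eq_or_lt with rfl | hlt
    · exact le_rfl
    · exact (hM3 η β α hlt).trans (hPG β _ _ (hM1 η β)).1
  have hne : Nonempty ι := by
    rw [← mk_ne_zero_iff, hι]
    exact Order.succ_ne_bot _
  choose U hU hUc using fun η => exists_iUnion (hmono η)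
  refine ⟨M, U, hM1, hM3, hM4, ?_, hU, ?_, ?_⟩
  · intro η α x hx
    by_cases h : Nonempty (Set.Iio α)
    · right
      simpa using hM5 η α h hx
    · rw [hM6 η α h] at hx
      exact Or.inl hx
  · intro η x hx
    rw [hUc] at hx
    exact Set.mem_iUnion.1 hx
  · intro η
    refine le_antisymm ((mk_set_le _).trans hι.le) ?_
    rw [← hι]
    exact card_le_of_strictly_increasing
      (fun α => (hG _ (η α) (hM1 η α).1 (hM1 η α).2).2.2)
      (fun α β h => subset (hM3 η β α h)) (fun α => subset (hU η α))

end Tree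

/-- The isomorphism class of a model in `Ω`. -/
def cls {κ : Cardinal.{u}} (M : K.SubModel Ω) (h : #M.carrier = κ) :
    Quotient (K.modelsSetoid κ) :=
  Quotient.mk _ ⟨⟨M.carrier, M.str⟩, M.mem, h⟩

theorem nonempty_equiv_of_cls_eq {κ : Cardinal.{u}} {M N : K.SubModel Ω} {hM : #M.carrier = κ}
    {hN : #N.carrier = κ} (h : M.cls hM = N.cls hN) : Nonempty (M.carrier ≃[L] N.carrier) :=
  Quotient.exact h

end SubModel

theorem categorical_of_numModels_eq_one (h : K.numModels μ = 1) : K.Categorical μ := by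
  intro M N _ _ hM hN hcM hcN
  have hs := (le_one_iff_subsingleton.1 h.le).elim
    (Quotient.mk (K.modelsSetoid μ) ⟨⟨M, inferInstance⟩, hM, hcM⟩)
    (Quotient.mk (K.modelsSetoid μ) ⟨⟨N, inferInstance⟩, hN, hcN⟩)
  exact Quotient.exact hs

theorem exists_model_of_one_le_numModels (h : 1 ≤ K.numModels μ) :
    ∃ (N : Type u) (_ : L.Structure N), K.Mem N ∧ #N = μ := by
  obtain ⟨q⟩ := mk_ne_zero_iff.1 (Cardinal.one_le_iff_ne_zero.1 h)
  obtain ⟨⟨N, hN⟩, -⟩ := Quotient.exists_rep q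
  exact ⟨N, _, hN⟩

end AEC

/-! ### Many models from incompatibility over a fixed base. -/

namespace AEC

open FirstOrder.Language

variable {L : FirstOrder.Language.{u, u}} {K : AEC L} {μ : Cardinal.{u}}

namespace SubModel

/-- Small families in `ι` are bounded. -/
theorem exists_forall_lt {ι : Type u} [LinearOrder ι] (hμ : ℵ₀ ≤ μ) (hι : #ι = Order.succ μ) (hIio : ∀ α : ι, #(Set.Iio α) ≤ μ)
    {I : Type u} (hI : #I ≤ μ) (f : I → ι) : ∃ γ, ∀ i, f i < γ := by
  by_contra! hcon
  have h1 : (Set.univ : Set ι) ⊆ ⋃ i, Set.Iic (f i) := fun γ _ =>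
    Set.mem_iUnion.2 (hcon γ)
  have h2 : #(⋃ i, Set.Iic (f i)) ≤ μ := card_iUnion_le hμ hI fun i => by
    rw [← Set.Iio_insert]
    exact mk_insert_le.trans ((add_le_add (hIio _) (one_le_aleph0.trans hμ)).trans
      (add_eq_self hμ).le)
  have h3 := (mk_le_mk_of_subset h1).trans h2
  rw [mk_univ, hι] at h3
  exact (Order.lt_succ μ).not_ge h3

section NonStructure

variable {ι : Type u} [LinearOrder ι] [WellFoundedLT ι]

theorem lift_mk_le_numModels {κ : Cardinal.{u}} {J Ω : Type u} (U : J → K.SubModel Ω)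
    (hU : ∀ j, #(U j).carrier = κ)
    (h : ∀ i j, i ≠ j → ¬ Nonempty ((U i).carrier ≃[L] (U j).carrier)) :
    lift.{u + 1} #J ≤ K.numModels κ := by
  have hinj : Function.Injective fun j => (U j).cls (hU j) := by
    intro i j hij
    by_contra hne
    exact h i j hne (nonempty_equiv_of_cls_eq hij)
  have hle := lift_mk_le_lift_mk_of_injective hinj
  rwa [lift_id'.{u, u + 1}] at hle

/-- If the members of a family are pairwise non-isomorphic over a common small submodel, then
there are many of them up to isomorphism. -/
theorem lift_power_le_numModels_of_base (hμ : ℵ₀ ≤ μ)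
    (h2 : (2 : Cardinal.{u}) ^ μ < 2 ^ Order.succ μ) {J Ω : Type u} (hΩ : #Ω ≤ 2 ^ μ)
    (hJ : #J = 2 ^ Order.succ μ) {base : K.SubModel Ω}
    (hbase : #base.carrier = μ) (U : J → K.SubModel Ω) (hbU : ∀ j, base ≤ U j)
    (hU : ∀ j, #(U j).carrier = Order.succ μ)
    (h : ∀ i j, i ≠ j → ¬ ∃ e : (U i).carrier ≃[L] (U j).carrier,
      ∀ x : base.carrier, (e ⟨x, mem_of_le (hbU i) x.2⟩ : Ω) = x) :
    lift.{u + 1} (2 ^ Order.succ μ) ≤ K.numModels (Order.succ μ) := by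
  by_contra! hlt
  have hJne : Nonempty J := by
    rw [← mk_ne_zero_iff, hJ]
    exact power_ne_zero _ two_ne_zero
  let c : J → Quotient (K.modelsSetoid (Order.succ μ)) := fun j => (U j).cls (hU j)
  let r : J → J := fun j => Function.invFun c (c j)
  have hr : ∀ j, Nonempty ((U j).carrier ≃[L] (U (r j)).carrier) := fun j =>
    nonempty_equiv_of_cls_eq (hM := hU j) (hN := hU _)
      (Function.invFun_eq (f := c) (b := c j) ⟨j, rfl⟩).symm
  have e := fun j => Classical.choice (hr j)
  -- Two models mapped to the same representative with the same restriction to `base` are isomorphic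
  -- over `base`. There are at most `(2 ^ μ) ^ μ = 2 ^ μ` restrictions, so few classes would leave
  -- fewer than `2 ^ μ⁺` pairs.
  let Φ : J → Quotient (K.modelsSetoid (Order.succ μ)) × (base.carrier → Ω) := fun j =>
    (c j, fun x => e j ⟨x, mem_of_le (hbU j) x.2⟩)
  have htransfer : ∀ {i j a b : J} (e₁ : (U i).carrier ≃[L] (U a).carrier)
      (e₂ : (U j).carrier ≃[L] (U b).carrier), a = b →
      (∀ x : base.carrier, (e₁ ⟨x, mem_of_le (hbU i) x.2⟩ : Ω) = e₂ ⟨x, mem_of_le (hbU j) x.2⟩) →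
      ∃ e : (U i).carrier ≃[L] (U j).carrier,
        ∀ x : base.carrier, (e ⟨x, mem_of_le (hbU i) x.2⟩ : Ω) = x := by
    rintro i j a b e₁ e₂ rfl hx
    refine ⟨e₂.symm.comp e₁, fun x => ?_⟩
    rw [Equiv.comp_apply, Subtype.ext (hx x), e₂.symm_apply_apply]
  have hinj : Function.Injective Φ := by
    intro i j hij
    by_contra hne
    have h1 : c i = c j := congrArg Prod.fst hij
    exact h i j hne (htransfer (e i) (e j) (congrArg (Function.invFun c) h1)
      fun x => congrFun (congrArg Prod.snd hij) x)
  have hle := lift_mk_le_lift_mk_of_injective hinj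
  rw [hJ, mk_prod, lift_id'.{u, u + 1}, lift_id'.{u, u + 1}] at hle
  have hfun : #(base.carrier → Ω) < 2 ^ Order.succ μ := by
    rw [← power_def, hbase]
    refine ((power_le_power_right hΩ).trans ?_).trans_lt h2
    rw [← power_mul, mul_eq_self hμ]
  refine absurd hle (not_le.2 (mul_lt_of_lt ?_ hlt (lift_lt.2 hfun)))
  rw [aleph0_le_lift]
  exact (hμ.trans (cantor μ).le).trans h2.le

/-- An isomorphism over `base` between the models of two branches would amalgamate, over `base`, the
two successors of the node where the branches separate. Hence all branches give models that are
non-isomorphic over `base`. -/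
theorem lift_power_le_numModels_of_not_amalgOver_base (hμ : ℵ₀ ≤ μ)
    (h2 : (2 : Cardinal.{u}) ^ μ < 2 ^ Order.succ μ)
    (hι : #ι = Order.succ μ) (hIio : ∀ α : ι, #(Set.Iio α) ≤ μ)
    {base : K.SubModel ι} (hbase : #base.carrier = μ) (G : K.SubModel ι → Bool → K.SubModel ι)
    (hG : ∀ M b, #M.carrier = μ → base ≤ M →
      M ≤ G M b ∧ #(G M b).carrier = μ ∧ ¬ (G M b).carrier ⊆ M.carrier)
    (hG' : ∀ M, #M.carrier = μ → base ≤ M → ¬ AmalgOver base (G M false) (G M true)) :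
    lift.{u + 1} (2 ^ Order.succ μ) ≤ K.numModels (Order.succ μ) := by
  obtain ⟨M, U, hM, -, hcongr, -, hU, -, hUcard⟩ := exists_modelTree hμ hι hIio hbase G hG
  have hne : Nonempty ι := by
    rw [← mk_ne_zero_iff, hι]
    exact Order.succ_ne_bot _
  obtain ⟨α₀⟩ := hne
  refine lift_power_le_numModels_of_base hμ h2 (hι.le.trans (Order.succ_le_of_lt (cantor μ)))
    (by simp [hι]) hbase U
    (fun η => ((hM η α₀).2.trans (hG _ (η α₀) (hM η α₀).1 (hM η α₀).2).1).trans (hU η α₀))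
    hUcard ?_
  rintro η ν hne ⟨e, he⟩
  obtain ⟨δ, hδ, hmin⟩ := (wellFounded_lt (α := ι)).has_min {δ | η δ ≠ ν δ}
    (Function.ne_iff.1 hne)
  have hm : M η δ = M ν δ := hcongr η ν δ fun β hβ => by
    by_contra h
    exact hmin β h hβ
  have hamalg : AmalgOver base (G (M η δ) (η δ)) (G (M η δ) (ν δ)) := by
    have hν := hU ν δ
    rw [← hm] at hν
    refine ⟨(U ν).carrier, inferInstance, e ∘ Set.inclusion (subset (hU η δ)),
      Set.inclusion (subset hν), (isStrongMap_equiv (U η).mem e).comp (isStrongMap (hU η δ)),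
      isStrongMap hν, fun x h₀ h₁ hb => Subtype.ext (he ⟨x, hb⟩)⟩
  have hnot := hG' (M η δ) (hM η δ).1 (hM η δ).2
  cases h₁ : η δ <;> cases h₂ : ν δ
  · exact hδ (h₁.trans h₂.symm)
  · rw [h₁, h₂] at hamalg
    exact hnot hamalg
  · rw [h₁, h₂] at hamalg
    exact hnot hamalg.symm
  · exact hδ (h₁.trans h₂.symm)

/-- `N₀` and `N₁` can be amalgamated so that points related by `r` are identified. -/
def AmalgVia {Ω : Type u} (r : Ω → Ω → Prop) (N₀ N₁ : K.SubModel Ω) : Prop :=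
  ∃ (R : Type u) (_ : L.Structure R) (g₀ : N₀.carrier → R) (g₁ : N₁.carrier → R),
    K.IsStrongMap g₀ ∧ K.IsStrongMap g₁ ∧
        ∀ (x : N₀.carrier) (y : N₁.carrier), r x y → g₀ x = g₁ y

/-- By Löwenheim–Skolem the amalgam can be cut down to cardinality `μ`, where amalgamation
hypotheses on models of that size apply to it. -/
theorem AmalgVia.exists_card {Ω : Type u} {r : Ω → Ω → Prop} {N₀ N₁ : K.SubModel Ω}
    (h : AmalgVia r N₀ N₁) (hLS : K.LS ≤ μ) (hμ : ℵ₀ ≤ μ) (h₀ : #N₀.carrier = μ)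
    (h₁ : #N₁.carrier = μ) :
    ∃ (R : Type u) (_ : L.Structure R) (g₀ : N₀.carrier → R) (g₁ : N₁.carrier → R), #R = μ ∧
      K.IsStrongMap g₀ ∧ K.IsStrongMap g₁ ∧
        ∀ (x : N₀.carrier) (y : N₁.carrier), r x y → g₀ x = g₁ y := by
  obtain ⟨R, _, g₀, g₁, hg₀, hg₁, h⟩ := h
  obtain ⟨R', _, i, f, g, hR', hi, hf, hg, rfl, rfl, -⟩ := exists_factor_card hLS hμ hg₀ hg₁
    h₀.le h₁.le (by rw [← h₀]; exact mk_le_of_injective hg₀.injective) ∅ (by simp)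
  exact ⟨R', _, f, g, hR', hf, hg, fun x y hxy => hi.injective (h x y hxy)⟩

end NonStructure

end SubModel

end AEC

/-! ### Many models by weak diamond. -/

namespace AEC

open FirstOrder.Language

variable {L : FirstOrder.Language.{u, u}} {K : AEC L} {μ : Cardinal.{u}}

namespace SubModel

variable {ι : Type u} [LinearOrder ι] [WellFoundedLT ι]

/-- If every model of cardinality `μ` has two extensions that cannot be amalgamated over it, one
of which is such that all of its extensions can be amalgamated over it, then weak diamond gives
many models of cardinality `μ⁺`. -/
theorem lift_power_le_numModels_of_not_amalgOver (hLS : K.LS ≤ μ) (hμ : ℵ₀ ≤ μ)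
    (h2 : (2 : Cardinal.{u}) ^ μ < 2 ^ Order.succ μ)
    (hι : #ι = Order.succ μ) (hIio : ∀ α : ι, #(Set.Iio α) ≤ μ)
    {base : K.SubModel ι} (hbase : #base.carrier = μ) (G : K.SubModel ι → Bool → K.SubModel ι)
    (hG : ∀ M b, #M.carrier = μ → base ≤ M →
      M ≤ G M b ∧ #(G M b).carrier = μ ∧ ¬ (G M b).carrier ⊆ M.carrier)
    (hG₁ : ∀ M, #M.carrier = μ → base ≤ M → ¬ AmalgOver M (G M false) (G M true))
    (hG₂ : ∀ M, #M.carrier = μ → base ≤ M → ∀ (E₀ E₁ : Type u) [L.Structure E₀] [L.Structure E₁]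
      (g₀ : (G M false).carrier → E₀) (g₁ : (G M false).carrier → E₁), #E₀ = μ → #E₁ = μ →
      K.IsStrongMap g₀ → K.IsStrongMap g₁ →
      ∃ (R : Type u) (_ : L.Structure R) (k₀ : E₀ → R) (k₁ : E₁ → R), K.IsStrongMap k₀ ∧
        K.IsStrongMap k₁ ∧
        ∀ x : (G M false).carrier, (x : ι) ∈ M.carrier → k₀ (g₀ x) = k₁ (g₁ x)) :
    lift.{u + 1} (2 ^ Order.succ μ) ≤ K.numModels (Order.succ μ) := by
  classical
  obtain ⟨M, U, hM, hGM, hcongr, hcont, hGU, hUc, hUcard⟩ :=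
    exists_modelTree hμ hι hIio hbase G hG
  have hMG : ∀ η α b, M η α ≤ G (M η α) b := fun η α b => (hG _ b (hM η α).1 (hM η α).2).1
  have hmono : ∀ η, Monotone (M η) := by
    intro η α β hαβ
    rcases hαβ.eq_or_lt with rfl | hlt
    · exact le_rfl
    · exact (hMG η α _).trans (hGM η β α hlt)
  have hMU : ∀ η α, M η α ≤ U η := fun η α => (hMG η α _).trans (hGU η α)
  have hι2 : #ι ≤ 2 ^ μ := hι.le.trans (Order.succ_le_of_lt (cantor μ))
  have h2inf : ℵ₀ ≤ (2 : Cardinal.{u}) ^ μ := hμ.trans (cantor μ).le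
  obtain ⟨S, hS, hdisj⟩ := exists_disjoint_not_weakDiamondSmall hμ hι h2 hIio
  have hZ : #((ι ⊕ ι) ⊕ (ι × ι)) ≤ 2 ^ μ := by
    simp only [mk_sum, mk_prod, lift_id]
    exact (add_le_add ((add_le_add hι2 hι2).trans (add_eq_self h2inf).le)
      ((mul_le_mul' hι2 hι2).trans (mul_eq_self h2inf).le)).trans (add_eq_self h2inf).le
  -- The set `s` codes two branches below `δ` and the graph of a partial map between their nodes.
  -- `F` asks whether the `false` successors of the two nodes amalgamate along that map.
  let F : ι → Set ((ι ⊕ ι) ⊕ (ι × ι)) → Bool := fun δ s =>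
    decide (AmalgVia (fun x y => Sum.inr (x, y) ∈ s)
      (G (M (fun β => decide (Sum.inl (Sum.inl β) ∈ s)) δ) false)
      (G (M (fun β => decide (Sum.inl (Sum.inr β) ∈ s)) δ) false))
  choose g hg using fun i => exists_guess hμ hι2 hIio (hS i) hZ F
  -- The branch of `X` follows the guess `g i` on `S i` for `i ∈ X` and turns to `false` elsewhere.
  -- Disjointness of the `S i` makes this unambiguous.
  let b : Set ι → ι → Bool := fun X δ => if h : ∃ i ∈ X, δ ∈ S i then g h.choose δ else false
  have hb₁ : ∀ X i δ, i ∈ X → δ ∈ S i → b X δ = g i δ := by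
    intro X i δ hi hδ
    have h : ∃ i ∈ X, δ ∈ S i := ⟨i, hi, hδ⟩
    have hi' : h.choose = i := by
      by_contra hne
      exact Set.disjoint_left.1 (hdisj hne) h.choose_spec.2 hδ
    refine (dif_pos h).trans ?_
    rw [hi']
  have hb₂ : ∀ X i δ, i ∉ X → δ ∈ S i → b X δ = false := by
    intro X i δ hi hδ
    refine dif_neg ?_
    rintro ⟨j, hj, hδj⟩
    refine Set.disjoint_left.1 (hdisj (?_ : j ≠ i)) hδj hδ
    rintro rfl
    exact hi hj
  have main : ∀ (X Y : Set ι) (i : ι), i ∈ X → i ∉ Y →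
      ¬ Nonempty ((U (b X)).carrier ≃[L] (U (b Y)).carrier) := by
    rintro X Y i hiX hiY ⟨e⟩
    set η := b X with hη
    set ν := b Y with hν
    let f : ι → ι := fun x => if h : x ∈ (U η).carrier then e ⟨x, h⟩ else x
    have hf : ∀ x : (U η).carrier, f x = e x := fun x => dif_pos x.2
    let A : ι → Set ((ι ⊕ ι) ⊕ (ι × ι)) := fun δ =>
      (fun β => Sum.inl (Sum.inl β)) '' {β | β < δ ∧ η β = true} ∪
      ((fun β => Sum.inl (Sum.inr β)) '' {β | β < δ ∧ ν β = true} ∪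
      (fun x => Sum.inr (x, f x)) '' (M η δ).carrier)
    -- One inclusion suffices: only points of `M η δ` have to be identified in the final amalgam.
    let C : Set ι := {δ | ∀ x ∈ (M η δ).carrier, f x ∈ (M ν δ).carrier}
    have hstep : ∀ α, ∃ γ, α < γ ∧ ∀ x ∈ (M η α).carrier, f x ∈ (M ν γ).carrier := by
      intro α
      have hex : ∀ x : (M η α).carrier, ∃ γ, f x ∈ (G (M ν γ) (ν γ)).carrier := fun x =>
        hUc ν _ (by
          rw [hf ⟨x, mem_of_le (hMU η α) x.2⟩]
          exact (e _).2)
      choose γ hγ using hex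
      obtain ⟨γ₁, hγ₁⟩ := exists_forall_lt hμ hι hIio (hM η α).1.le γ
      obtain ⟨γ₂, hγ₂⟩ := exists_forall_lt hμ hι hIio (I := PUnit.{u + 1})
        (by simpa using one_le_aleph0.trans hμ) fun _ => α
      refine ⟨max γ₁ γ₂, (hγ₂ ⟨⟩).trans_le (le_max_right _ _), fun x hx => ?_⟩
      exact mem_of_le (hGM ν _ _ ((hγ₁ ⟨x, hx⟩).trans_le (le_max_left _ _))) (hγ ⟨x, hx⟩)
    choose φ hφ hφf using hstep
    have hunb : ∀ α, ∃ c ∈ C, α < c := by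
      intro α
      -- The supremum `δ` of these iterates lies in `C`: by continuity a point of `M η δ` occurs
      -- below some `a n`, and its image occurs by stage `a (n + 1)` or shortly after, still below
      -- `δ`.
      let a : ℕ → ι := fun n => φ^[n] α
      have ha : ∀ n, a (n + 1) = φ (a n) := fun n => Function.iterate_succ_apply' φ n α
      obtain ⟨γ, hγ⟩ := exists_forall_lt hμ hι hIio (I := ULift.{u} ℕ) (by simpa using hμ)
        fun n => a n.down
      obtain ⟨δ, hδ, hmin⟩ := (wellFounded_lt (α := ι)).has_min {δ | ∀ n, a n < δ}
        ⟨γ, fun n => hγ ⟨n⟩⟩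
      have hmem : ∀ n x, x ∈ (M η (a n)).carrier → f x ∈ (M ν δ).carrier := by
        intro n x hx
        have h1 := hφf _ x hx
        rw [← ha] at h1
        exact mem_of_le (hmono ν (hδ (n + 1)).le) h1
      refine ⟨δ, fun x hx => ?_, hδ 0⟩
      rcases hcont η δ x hx with h | ⟨β, hβ, h⟩
      · exact hmem 0 x (mem_of_le (hM η _).2 h)
      · have h1 : ¬ ∀ n, a n < β := fun h' => hmin β h' hβ
        push Not at h1
        obtain ⟨n, hn⟩ := h1
        refine hmem (n + 1) x (mem_of_le (hGM η _ _ (hn.trans_lt ?_)) h)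
        rw [ha]
        exact hφ _
    have hclosed : ∀ δ, (∃ c ∈ C, c ≤ δ) → (∀ α < δ, ∃ c ∈ C, α < c ∧ c ≤ δ) → δ ∈ C := by
      rintro δ ⟨c, hc, hcδ⟩ h x hx
      rcases hcont η δ x hx with hx' | ⟨β, hβ, hx'⟩
      · exact mem_of_le (hmono ν hcδ) (hc x (mem_of_le (hM η c).2 hx'))
      · obtain ⟨c', hc', hβc', hc'δ⟩ := h β hβ
        exact mem_of_le (hmono ν hc'δ) (hc' x (mem_of_le (hGM η _ _ hβc') hx'))
    have hAmono : Monotone A := by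
      intro α β hαβ
      refine Set.union_subset_union (Set.image_mono fun γ h => ⟨h.1.trans_le hαβ, h.2⟩)
        (Set.union_subset_union (Set.image_mono fun γ h => ⟨h.1.trans_le hαβ, h.2⟩)
        (Set.image_mono (subset (hmono η hαβ))))
    have hAcard : ∀ α, #(A α) ≤ μ := by
      intro α
      have h1 : ∀ ξ : ι → Bool, #{β | β < α ∧ ξ β = true} ≤ μ := fun ξ =>
        (mk_le_mk_of_subset fun β h => h.1).trans (hIio α)
      refine (mk_union_le _ _).trans ((add_le_add (mk_image_le.trans (h1 η))
        ((mk_union_le _ _).trans (add_le_add (mk_image_le.trans (h1 ν))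
        (mk_image_le.trans (hM η α).1.le)))).trans ?_)
      rw [add_eq_self hμ, add_eq_self hμ]
    have hAcont : ∀ δ, ∀ z ∈ A δ, (∀ γ, z ∈ A γ) ∨ ∃ β < δ, ∀ γ, β < γ → z ∈ A γ := by
      rintro δ z (⟨β, hβ, rfl⟩ | ⟨β, hβ, rfl⟩ | ⟨x, hx, rfl⟩)
      · exact Or.inr ⟨β, hβ.1, fun γ hγ => Or.inl ⟨β, ⟨hγ, hβ.2⟩, rfl⟩⟩
      · exact Or.inr ⟨β, hβ.1, fun γ hγ => Or.inr (Or.inl ⟨β, ⟨hγ, hβ.2⟩, rfl⟩)⟩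
      · rcases hcont η δ x hx with hx' | ⟨β, hβ, hx'⟩
        · exact Or.inl fun γ => Or.inr (Or.inr ⟨x, mem_of_le (hM η γ).2 hx', rfl⟩)
        · exact Or.inr ⟨β, hβ, fun γ hγ =>
            Or.inr (Or.inr ⟨x, mem_of_le (hGM η _ _ hγ) hx', rfl⟩)⟩
    obtain ⟨δ, hδS, hδC, hFδ⟩ := hg i A C hAmono hAcard hAcont hunb hclosed
    have hηδ : η δ = g i δ := hb₁ X i δ hiX hδS
    have hνδ : ν δ = false := hb₂ Y i δ hiY hδS
    -- The code determines the branch only below `δ`, which is all that the node at `δ` depends on.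
    have hdec₁ : ∀ d : ∀ β, Decidable (Sum.inl (Sum.inl β) ∈ A δ),
        M (fun β => @decide _ (d β)) δ = M η δ := by
      refine fun d => hcongr _ _ _ fun β hβ => ?_
      cases h : η β <;> simp [A, h, hβ]
    have hdec₂ : ∀ d : ∀ β, Decidable (Sum.inl (Sum.inr β) ∈ A δ),
        M (fun β => @decide _ (d β)) δ = M ν δ := by
      refine fun d => hcongr _ _ _ fun β hβ => ?_
      cases h : ν β <;> simp [A, h, hβ]
    have hdec₃ : ∀ x y, Sum.inr (x, y) ∈ A δ ↔ x ∈ (M η δ).carrier ∧ f x = y := by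
      intro x y
      simp [A]
    have hFiff : F δ (A δ) = true ↔ AmalgVia (fun x y => x ∈ (M η δ).carrier ∧ f x = y)
        (G (M η δ) false) (G (M ν δ) false) := by
      simp only [F, decide_eq_true_eq, hdec₁, hdec₂, hdec₃]
    have hG' := fun b => hG _ b (hM η δ).1 (hM η δ).2
    have hYU : G (M ν δ) false ≤ U ν := by
      have := hGU ν δ
      rwa [hνδ] at this
    have hvia : AmalgVia (fun x y => x ∈ (M η δ).carrier ∧ f x = y)
        (G (M η δ) (η δ)) (G (M ν δ) false) := by
      refine ⟨(U ν).carrier, inferInstance, e ∘ Set.inclusion (subset (hGU η δ)),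
        Set.inclusion (subset hYU), (isStrongMap_equiv (U η).mem e).comp (isStrongMap (hGU η δ)),
        isStrongMap hYU, ?_⟩
      rintro x y ⟨-, hxy⟩
      exact Subtype.ext ((hf ⟨x, mem_of_le (hGU η δ) x.2⟩).symm.trans hxy)
    -- Here `η δ` equals the value of `F`, while `ν δ = false`. If `F` says no, then `η δ = false`
    -- and `e` itself provides the amalgam denied by `F`. If `F` says yes, then `η δ = true`, so
    -- both successors of `M η δ` amalgamate along `f` with the `false` successor of `M ν δ`; the
    -- two amalgams can be joined over `M ν δ` by `hG₂`, contradicting `hG₁`.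
    cases hF : F δ (A δ)
    · rw [← hFδ, hF] at hηδ
      rw [hηδ, ← hFiff, hF] at hvia
      exact Bool.false_ne_true hvia
    · have hvia' := hFiff.1 hF
      rw [← hFδ, hF] at hηδ
      rw [hηδ] at hvia
      have hGν := hG _ false (hM ν δ).1 (hM ν δ).2
      obtain ⟨R, _, p₀, p₁, hR, hp₀, hp₁, hp⟩ := hvia'.exists_card hLS hμ (hG' false).2.1 hGν.2.1
      obtain ⟨R', _, q₀, q₁, hR', hq₀, hq₁, hq⟩ := hvia.exists_card hLS hμ (hG' true).2.1 hGν.2.1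
      obtain ⟨R'', _, k₀, k₁, hk₀, hk₁, hk⟩ := hG₂ _ (hM ν δ).1 (hM ν δ).2 R R' p₁ q₁ hR hR' hp₁ hq₁
      refine hG₁ _ (hM η δ).1 (hM η δ).2 ⟨R'', _, k₀ ∘ p₀, k₁ ∘ q₀, hk₀.comp hp₀, hk₁.comp hq₀, ?_⟩
      intro x h₀ h₁ hx
      have hfx := hδC x hx
      have h₃ := hp ⟨x, h₀⟩ ⟨f x, mem_of_le hGν.1 hfx⟩ ⟨hx, rfl⟩
      have h₄ := hq ⟨x, h₁⟩ ⟨f x, mem_of_le hGν.1 hfx⟩ ⟨hx, rfl⟩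
      rw [Function.comp_apply, Function.comp_apply, h₃, h₄]
      exact hk _ hfx
  have hcard : #(Set ι) = 2 ^ Order.succ μ := by rw [mk_set, hι]
  rw [← hcard]
  refine lift_mk_le_numModels (fun X => U (b X)) (fun X => hUcard _) ?_
  rintro X Y hne ⟨e⟩
  by_cases hsub : X ⊆ Y
  · obtain ⟨i, hi, hi'⟩ := Set.not_subset.1 fun h => hne (hsub.antisymm h)
    exact main Y X i hi hi' ⟨e.symm⟩
  · obtain ⟨i, hi, hi'⟩ := Set.not_subset.1 hsub
    exact main X Y i hi hi' ⟨e⟩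

end SubModel

end AEC

/-! ### Amalgamation from few models, and existence of a maximal model. -/

namespace AEC

open FirstOrder.Language

variable {L : FirstOrder.Language.{u, u}} {K : AEC L} {μ : Cardinal.{u}}

theorem exists_wellOrder_succ (μ : Cardinal.{u}) :
    ∃ (ι : Type u) (_ : LinearOrder ι) (_ : WellFoundedLT ι), #ι = Order.succ μ ∧
      ∀ α : ι, #(Set.Iio α) ≤ μ :=
  ⟨(Order.succ μ).ord.ToType, inferInstance, inferInstance, mk_ord_toType _,
    fun α => Order.le_of_lt_succ ((mk_Iio_lt α (by simp)).trans_eq (mk_ord_toType _))⟩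

/-- Categoricity in `μ`, few models in `μ⁺` and weak diamond imply amalgamation in `μ`. -/
theorem amalgamationProperty_of_numModels_lt (hLS : K.LS ≤ μ) (hμ : ℵ₀ ≤ μ)
    (h2 : (2 : Cardinal.{u}) ^ μ < 2 ^ Order.succ μ) (hcat : K.Categorical μ)
    (hex : ∃ (N : Type u) (_ : L.Structure N), K.Mem N ∧ #N = Order.succ μ)
    (hI : K.numModels (Order.succ μ) < lift.{u + 1} (2 ^ Order.succ μ)) :
    K.AmalgamationProperty μ := by
  obtain ⟨ι, _, _, hι, hIio⟩ := exists_wellOrder_succ μ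
  obtain ⟨N, _, hN, hNcard⟩ := hex
  obtain ⟨S, hS, -, hScard⟩ := K.exists_strongMap_of_LS_le hLS hN ∅ (by simp)
    (by rw [hNcard]; exact Order.le_succ μ)
  obtain ⟨base, ⟨θ₀⟩⟩ := SubModel.exists_copy (Ω := ι) (K.mem_of_strong hS).1
    (by rw [hScard, hι]; exact Order.le_succ μ)
  have hbase : #base.carrier = μ := by rw [← hScard]; exact (mk_congr θ₀.toEquiv).symm
  by_contra hAP
  have hNA : ∀ (M : Type u) [L.Structure M], K.Mem M → #M = μ →
      ∃ (B C : Type u) (_ : L.Structure B) (_ : L.Structure C) (f : M → B) (g : M → C),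
        #B = μ ∧ #C = μ ∧ K.IsStrongMap f ∧ K.IsStrongMap g ∧ ¬ K.Amalgamable f g := by
    intro M _ hM hMcard
    simp only [AmalgamationProperty] at hAP
    push Not at hAP
    obtain ⟨A, B, C, _, _, _, f, g, hA, hB, hC, hf, hg, hfg⟩ := hAP
    obtain ⟨e⟩ := hcat M A hM hf.mem_left hMcard hA
    refine ⟨B, C, _, _, f ∘ e, g ∘ e, hB, hC, hf.comp (isStrongMap_equiv hM e),
      hg.comp (isStrongMap_equiv hM e), fun h => hfg ?_⟩
    have := h.comp e.symm
    simpa [Function.comp_assoc, Function.comp_def] using this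
  -- The dichotomy: either some extension `B` of some `A` makes all further extensions amalgamable
  -- over `A`, and categoricity spreads this to every model, or incompatibility over a fixed `base`
  -- can be produced above every extension of it.
  by_cases hcase : ∃ (A B : Type u) (_ : L.Structure A) (_ : L.Structure B) (f : A → B),
      #A = μ ∧ #B = μ ∧ K.IsStrongMap f ∧ ∀ (E₀ E₁ : Type u) [L.Structure E₀] [L.Structure E₁]
        (g₀ : B → E₀) (g₁ : B → E₁), #E₀ = μ → #E₁ = μ → K.IsStrongMap g₀ → K.IsStrongMap g₁ →
        K.Amalgamable (g₀ ∘ f) (g₁ ∘ f)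
  · have hWA : ∀ (M : Type u) [L.Structure M], K.Mem M → #M = μ →
        ∃ (B : Type u) (_ : L.Structure B) (f : M → B), #B = μ ∧ K.IsStrongMap f ∧
          ∀ (E₀ E₁ : Type u) [L.Structure E₀] [L.Structure E₁] (g₀ : B → E₀) (g₁ : B → E₁),
          #E₀ = μ → #E₁ = μ → K.IsStrongMap g₀ → K.IsStrongMap g₁ →
          K.Amalgamable (g₀ ∘ f) (g₁ ∘ f) := by
      intro M _ hM hMcard
      obtain ⟨A, B, _, _, f, hA, hB, hf, h⟩ := hcase
      obtain ⟨e⟩ := hcat M A hM hf.mem_left hMcard hA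
      exact ⟨B, _, f ∘ e, hB, hf.comp (isStrongMap_equiv hM e),
        fun E₀ E₁ _ _ g₀ g₁ h₀ h₁ hg₀ hg₁ => (h E₀ E₁ g₀ g₁ h₀ h₁ hg₀ hg₁).comp e⟩
    have hstep : ∀ M : K.SubModel ι, ∃ G : Bool → K.SubModel ι, #M.carrier = μ →
        (∀ b, M ≤ G b ∧ #(G b).carrier = μ ∧ ¬ (G b).carrier ⊆ M.carrier) ∧
        ¬ SubModel.AmalgOver M (G false) (G true) ∧
        ∀ (E₀ E₁ : Type u) [L.Structure E₀] [L.Structure E₁] (g₀ : (G false).carrier → E₀)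
          (g₁ : (G false).carrier → E₁), #E₀ = μ → #E₁ = μ → K.IsStrongMap g₀ →
          K.IsStrongMap g₁ → ∃ (R : Type u) (_ : L.Structure R) (k₀ : E₀ → R) (k₁ : E₁ → R),
            K.IsStrongMap k₀ ∧ K.IsStrongMap k₁ ∧
            ∀ x : (G false).carrier, (x : ι) ∈ M.carrier → k₀ (g₀ x) = k₁ (g₁ x) := by
      intro M
      by_cases hM : #M.carrier = μ
      swap
      · exact ⟨fun _ => M, fun h => absurd h hM⟩
      obtain ⟨B, C, _, _, f, g, hB, hC, hf, hg, hfg⟩ := hNA M.carrier M.mem hM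
      -- Enlarging `B` preserves incompatibility with `C`. Extensions of `B'` amalgamate over `B`,
      -- hence over `M`.
      obtain ⟨B', _, k, hB', hk, hk'⟩ := hWA B hf.mem_right hB
      obtain ⟨N₀, θ₀, hN₀, hθ₀⟩ := M.exists_extension_of_card hμ hι hM.le (hk.comp hf) hB'.le
      obtain ⟨N₁, θ₁, hN₁, hθ₁⟩ := M.exists_extension_of_card hμ hι hM.le hg hC.le
      have hN₀c : #N₀.carrier = μ := by rw [← hB']; exact (mk_congr θ₀.toEquiv).symm
      have hN₁c : #N₁.carrier = μ := by rw [← hC]; exact (mk_congr θ₁.toEquiv).symm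
      have hna : ¬ SubModel.AmalgOver M N₀ N₁ := by
        rintro ⟨R, _, g₀, g₁, hg₀, hg₁, h⟩
        refine hfg ⟨R, _, g₀ ∘ θ₀ ∘ k, g₁ ∘ θ₁,
          hg₀.comp ((isStrongMap_equiv hk.mem_right θ₀).comp hk),
          hg₁.comp (isStrongMap_equiv hg.mem_right θ₁), fun x => ?_⟩
        have h0 : θ₀ (k (f x)) = ⟨x, SubModel.mem_of_le hN₀ x.2⟩ := Subtype.ext (hθ₀ x)
        have h1 : θ₁ (g x) = ⟨x, SubModel.mem_of_le hN₁ x.2⟩ := Subtype.ext (hθ₁ x)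
        simp only [Function.comp_apply, h0, h1]
        exact h x _ _ x.2
      refine ⟨fun b => cond b N₁ N₀, fun _ => ⟨?_, hna, ?_⟩⟩
      · rintro (_ | _)
        · exact ⟨hN₀, hN₀c, SubModel.not_subset_of_not_amalgOver hN₀ hN₁ hna⟩
        · exact ⟨hN₁, hN₁c, SubModel.not_subset_of_not_amalgOver hN₁ hN₀ fun h => hna h.symm⟩
      · intro E₀ E₁ _ _ g₀ g₁ hE₀ hE₁ hg₀ hg₁
        have hθs := isStrongMap_equiv hk.mem_right θ₀
        obtain ⟨R, _, k₀, k₁, hk₀, hk₁, h⟩ := hk' E₀ E₁ _ _ hE₀ hE₁ (hg₀.comp hθs) (hg₁.comp hθs)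
        refine ⟨R, _, k₀, k₁, hk₀, hk₁, fun x hx => ?_⟩
        have h0 : θ₀ (k (f ⟨x, hx⟩)) = x := Subtype.ext (hθ₀ ⟨x, hx⟩)
        have := h (f ⟨x, hx⟩)
        simp only [Function.comp_apply] at this
        rwa [h0] at this
    choose G hG using hstep
    exact absurd hI (not_lt.2 (SubModel.lift_power_le_numModels_of_not_amalgOver hLS hμ h2 hι hIio
      hbase G (fun M b hM _ => (hG M hM).1 b) (fun M hM _ => (hG M hM).2.1)
      (fun M hM _ => (hG M hM).2.2)))
  · push Not at hcase
    have hstep : ∀ M : K.SubModel ι, ∃ G : Bool → K.SubModel ι, #M.carrier = μ → base ≤ M →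
        (∀ b, M ≤ G b ∧ #(G b).carrier = μ ∧ ¬ (G b).carrier ⊆ M.carrier) ∧
        ¬ SubModel.AmalgOver base (G false) (G true) := by
      intro M
      by_cases hM : #M.carrier = μ ∧ base ≤ M
      swap
      · exact ⟨fun _ => M, fun h h' => absurd ⟨h, h'⟩ hM⟩
      obtain ⟨hM, hbM⟩ := hM
      obtain ⟨B, C, _, _, f, g, hB, hC, hf, hg, hfg⟩ := hcase base.carrier M.carrier _ _ _ hbase hM
        (SubModel.isStrongMap hbM)
      obtain ⟨N₀, θ₀, hN₀, hθ₀⟩ := M.exists_extension_of_card hμ hι hM.le hf hB.le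
      obtain ⟨N₁, θ₁, hN₁, hθ₁⟩ := M.exists_extension_of_card hμ hι hM.le hg hC.le
      have hN₀c : #N₀.carrier = μ := by rw [← hB]; exact (mk_congr θ₀.toEquiv).symm
      have hN₁c : #N₁.carrier = μ := by rw [← hC]; exact (mk_congr θ₁.toEquiv).symm
      have hna : ¬ SubModel.AmalgOver base N₀ N₁ := by
        rintro ⟨R, _, g₀, g₁, hg₀, hg₁, h⟩
        refine hfg ⟨R, _, g₀ ∘ θ₀, g₁ ∘ θ₁, hg₀.comp (isStrongMap_equiv hf.mem_right θ₀),
          hg₁.comp (isStrongMap_equiv hg.mem_right θ₁), fun x => ?_⟩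
        set y := Set.inclusion (SubModel.subset hbM) x with hy
        have h0 : θ₀ (f y) = ⟨y, SubModel.mem_of_le hN₀ y.2⟩ := Subtype.ext (hθ₀ y)
        have h1 : θ₁ (g y) = ⟨y, SubModel.mem_of_le hN₁ y.2⟩ := Subtype.ext (hθ₁ y)
        simp only [Function.comp_apply, ← hy, h0, h1]
        exact h y _ _ x.2
      have hna' : ¬ SubModel.AmalgOver M N₀ N₁ := by
        rintro ⟨R, _, g₀, g₁, hg₀, hg₁, h⟩
        exact hna ⟨R, _, g₀, g₁, hg₀, hg₁, fun x h₀ h₁ hx => h x h₀ h₁ (SubModel.mem_of_le hbM hx)⟩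
      refine ⟨fun b => cond b N₁ N₀, fun _ _ => ⟨?_, hna⟩⟩
      rintro (_ | _)
      · exact ⟨hN₀, hN₀c, SubModel.not_subset_of_not_amalgOver hN₀ hN₁ hna'⟩
      · exact ⟨hN₁, hN₁c, SubModel.not_subset_of_not_amalgOver hN₁ hN₀ fun h => hna' h.symm⟩
    choose G hG using hstep
    exact absurd hI (not_lt.2 (SubModel.lift_power_le_numModels_of_not_amalgOver_base hμ h2 hι hIio
      hbase G (fun M b hM hb => (hG M hM hb).1 b) (fun M hM hb => (hG M hM hb).2)))

/-- If `K` has models of cardinality `κ` but none of cardinality `κ⁺`, then it has a model of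
cardinality `κ` without proper extensions. -/
theorem exists_maximal {κ : Cardinal.{u}} (hLS : K.LS ≤ κ) (hκ : ℵ₀ ≤ κ)
    (hex : ∃ (N : Type u) (_ : L.Structure N), K.Mem N ∧ #N = κ)
    (hempty : IsEmpty (K.Models (Order.succ κ))) :
    ∃ (N : Type u) (_ : L.Structure N), K.Mem N ∧ #N = κ ∧
      ∀ (R : Type u) [L.Structure R] (g : N → R), K.IsStrongMap g → Function.Surjective g := by
  obtain ⟨ι, _, _, hι, hIio⟩ := exists_wellOrder_succ κ
  obtain ⟨N, _, hN, hNcard⟩ := hex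
  obtain ⟨base, ⟨θ₀⟩⟩ := SubModel.exists_copy (Ω := ι) hN
    (by rw [hNcard, hι]; exact Order.le_succ κ)
  have hbase : #base.carrier = κ := by rw [← hNcard]; exact (mk_congr θ₀.toEquiv).symm
  by_contra! hcon
  have hstep : ∀ M : K.SubModel ι, ∃ G : K.SubModel ι, #M.carrier = κ →
      M ≤ G ∧ #G.carrier = κ ∧ ¬ G.carrier ⊆ M.carrier := by
    intro M
    by_cases hM : #M.carrier = κ
    swap
    · exact ⟨M, fun h => absurd h hM⟩
    obtain ⟨R, _, g, hg, hns⟩ := hcon M.carrier M.str M.mem hM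
    rw [Function.Surjective] at hns
    push Not at hns
    obtain ⟨x, hx⟩ := hns
    -- The proper extension may be too large; it is cut down to cardinality `κ`, keeping the new
    -- point `x`.
    obtain ⟨R', _, i, f, -, hR', hi, hf, -, hif, -, hD⟩ := exists_factor_card hLS hκ hg hg hM.le
      hM.le (by rw [← hM]; exact mk_le_of_injective hg.injective) {x}
      (by simpa using one_le_aleph0.trans hκ)
    obtain ⟨G, θ, hG, hθ⟩ := M.exists_extension_of_card hκ hι hM.le hf hR'.le
    refine ⟨G, fun _ => ⟨hG, by rw [← hR']; exact (mk_congr θ.toEquiv).symm, fun hsub => ?_⟩⟩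
    obtain ⟨y, hy⟩ := hD rfl
    apply hx ⟨θ y, hsub (θ y).2⟩
    have h1 : f ⟨θ y, hsub (θ y).2⟩ = y := θ.injective (Subtype.ext (hθ _))
    rw [← hif, Function.comp_apply, h1, hy]
  choose G hG using hstep
  obtain ⟨-, U, -, -, -, -, -, -, hU⟩ := SubModel.exists_modelTree hκ hι hIio hbase
    (fun M _ => G M) fun M b hM _ => hG M hM
  exact hempty.elim ⟨⟨(U fun _ => true).carrier, (U fun _ => true).str⟩, (U fun _ => true).mem,
    hU _⟩

end AEC

/-! ### Partial maps out of a large model, and amalgamation of cardinalities `μ⁺` and `μ`. -/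

namespace AEC

open FirstOrder.Language

variable {L : FirstOrder.Language.{u, u}} {K : AEC L} {μ : Cardinal.{u}}

variable (K) in
/-- A model in `Ω`, together with the graph of a partial map between `N` and the model, whose
projections are `K`-embeddings. -/
structure EmbState (N : Type u) [L.Structure N] (Ω : Type u) where
  graph : K.SubModel (N × Ω)
  model : K.SubModel Ω
  left : K.IsStrongMap fun z : graph.carrier => z.1.1
  mem_model : ∀ z ∈ graph.carrier, z.2 ∈ model.carrier
  right : K.IsStrongMap fun z : graph.carrier => (⟨z.1.2, mem_model z.1 z.2⟩ : model.carrier)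

namespace EmbState

variable {N Ω : Type u} [L.Structure N]

instance : Preorder (K.EmbState N Ω) where
  le s t := s.graph ≤ t.graph ∧ s.model ≤ t.model
  le_refl s := ⟨le_rfl, le_rfl⟩
  le_trans _ _ _ h₁ h₂ := ⟨h₁.1.trans h₂.1, h₁.2.trans h₂.2⟩

/-- The first projection of the graph. -/
def fst (s : K.EmbState N Ω) (z : s.graph.carrier) : N := z.1.1

/-- The second projection of the graph. -/
def snd (s : K.EmbState N Ω) (z : s.graph.carrier) : s.model.carrier :=
  ⟨z.1.2, s.mem_model z.1 z.2⟩

theorem isStrongMap_fst (s : K.EmbState N Ω) : K.IsStrongMap s.fst := s.left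

theorem isStrongMap_snd (s : K.EmbState N Ω) : K.IsStrongMap s.snd := s.right

theorem exists_iUnion {I : Type u} [LinearOrder I] [WellFoundedLT I] [Nonempty I]
    {C : I → K.EmbState N Ω} (hC : Monotone C) :
    ∃ t : K.EmbState N Ω, (∀ i, C i ≤ t) ∧ t.graph.carrier = (⋃ i, (C i).graph.carrier) ∧
      t.model.carrier = ⋃ i, (C i).model.carrier := by
  have hg : Monotone fun i => (C i).graph := fun i j h => (hC h).1
  obtain ⟨Γ, hΓ, hΓc⟩ := SubModel.exists_iUnion hg
  obtain ⟨R, hR, hRc⟩ := SubModel.exists_iUnion (C := fun i => (C i).model) fun i j h => (hC h).2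
  refine ⟨⟨Γ, R, ?_, ?_, ?_⟩, fun i => ⟨hΓ i, hR i⟩, hΓc, hRc⟩
  · exact SubModel.isStrongMap_of_iUnion hg hΓ hΓc fun i => (C i).left
  · intro z hz
    rw [hΓc] at hz
    obtain ⟨i, hi⟩ := Set.mem_iUnion.1 hz
    exact SubModel.mem_of_le (hR i) ((C i).mem_model z hi)
  · exact SubModel.isStrongMap_of_iUnion hg hΓ hΓc fun i =>
      (SubModel.isStrongMap (hR i)).comp (C i).right

theorem exists_of_maps {A R : Type u} [L.Structure A] [L.Structure R] {l : A → N} {r : A → R}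
    (hl : K.IsStrongMap l) (hr : K.IsStrongMap r) {model : K.SubModel Ω} (θ : R ≃[L] model.carrier) :
    ∃ (s : K.EmbState N Ω) (θ' : A ≃[L] s.graph.carrier), s.model = model ∧
      ∀ a, (θ' a : N × Ω) = (l a, (θ (r a) : Ω)) := by
  obtain ⟨Γ, θ', hθ'⟩ := SubModel.exists_of_injective hl.mem_left
    (fun a => (l a, (θ (r a) : Ω))) fun a b hab => hl.injective (congrArg Prod.fst hab)
  have hsymm : ∀ z : Γ.carrier, (z : N × Ω) = (l (θ'.symm z), (θ (r (θ'.symm z)) : Ω)) := by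
    intro z
    rw [← hθ', θ'.apply_symm_apply]
  have hs := isStrongMap_equiv Γ.mem θ'.symm
  have hmem : ∀ z ∈ Γ.carrier, z.2 ∈ model.carrier := fun z hz => by
    have := congrArg Prod.snd (hsymm ⟨z, hz⟩)
    simp only at this
    rw [this]
    exact (θ _).2
  refine ⟨⟨Γ, model, ?_, hmem, ?_⟩, θ', rfl, hθ'⟩
  · have : (fun z : Γ.carrier => z.1.1) = l ∘ θ'.symm :=
      funext fun z => congrArg Prod.fst (hsymm z)
    rw [this]
    exact hl.comp hs
  · have : (fun z : Γ.carrier => (⟨z.1.2, hmem z.1 z.2⟩ : model.carrier)) = θ ∘ r ∘ θ'.symm :=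
      funext fun z => Subtype.ext (congrArg Prod.snd (hsymm z))
    rw [this]
    exact (isStrongMap_equiv hr.mem_right θ).comp (hr.comp hs)

/-- Old points of `R` keep their names in `Ω`, and a point of `A` is named by its two images.
Compatibility of the maps then makes the new graph contain the old one, and room is needed only for
`R`. -/
theorem exists_extension (s : K.EmbState N Ω) {A R : Type u} [L.Structure A] [L.Structure R]
    {i : s.graph.carrier → A} {l : A → N} {r : A → R} {h : s.model.carrier → R}
    (hi : K.IsStrongMap i) (hl : K.IsStrongMap l) (hr : K.IsStrongMap r) (hh : K.IsStrongMap h)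
    (hil : ∀ z, l (i z) = s.fst z) (hir : ∀ z, r (i z) = h (s.snd z))
    (hroom : #R ≤ #(s.model.carrierᶜ : Set Ω)) :
    ∃ (t : K.EmbState N Ω) (θ : R ≃[L] t.model.carrier) (θ' : A ≃[L] t.graph.carrier), s ≤ t ∧
      (∀ x, (θ (h x) : Ω) = x) ∧ ∀ a, (θ' a : N × Ω) = (l a, (θ (r a) : Ω)) := by
  obtain ⟨model, θ, hle, hθ⟩ := s.model.exists_extension hh hroom
  obtain ⟨t, θ', rfl, hθ'⟩ := exists_of_maps hl hr θ
  have hθi : ∀ z : s.graph.carrier, (θ' (i z) : N × Ω) = z := fun z => by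
    rw [hθ', hil, hir, hθ]
    rfl
  refine ⟨t, θ, θ', ⟨⟨fun z hz => ?_, ?_⟩, hle⟩, hθ, hθ'⟩
  · have := (θ' (i ⟨z, hz⟩)).2
    rwa [hθi] at this
  · convert (isStrongMap_equiv hi.mem_right θ').comp hi using 1
    funext z
    exact Subtype.ext (hθi z).symm

end EmbState

/-- Amalgamation in `μ` gives amalgamation of a model of cardinality `μ⁺` and a model of
cardinality `μ` over a model of cardinality `μ`. -/
theorem AmalgamationProperty.amalgamable_succ (hAP : K.AmalgamationProperty μ) (hLS : K.LS ≤ μ)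
    (hμ : ℵ₀ ≤ μ) {A B N : Type u} [L.Structure A] [L.Structure B] [L.Structure N] {f : A → N}
    {g : A → B} (hA : #A = μ) (hB : #B = μ) (hN : #N = Order.succ μ) (hf : K.IsStrongMap f)
    (hg : K.IsStrongMap g) : K.Amalgamable f g := by
  obtain ⟨ι, _, _, hι, hIio⟩ := exists_wellOrder_succ μ
  obtain ⟨enum⟩ : Nonempty (ι ≃ N) := Cardinal.eq.1 (hι.trans hN.symm)
  obtain ⟨model, ⟨θ₀⟩⟩ := SubModel.exists_copy (Ω := ι) hg.mem_right
    (by rw [hB, hι]; exact Order.le_succ μ)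
  obtain ⟨base, θ₀', rfl, hθ₀'⟩ := EmbState.exists_of_maps hf hg θ₀
  let P : K.EmbState N ι → Prop := fun s => #s.graph.carrier = μ ∧ #s.model.carrier = μ
  have hbase : P base := ⟨by rw [← hA]; exact (mk_congr θ₀'.toEquiv).symm,
    by rw [← hB]; exact (mk_congr θ₀.toEquiv).symm⟩
  have hstep : ∀ (α : ι) (s : K.EmbState N ι), ∃ t : K.EmbState N ι, P s → s ≤ t ∧ P t ∧
      -- Stage `α` puts the `α`-th element of `N` into the domain, so after `μ⁺` stages the first
      -- projection is an isomorphism onto `N`.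
      ∃ z ∈ t.graph.carrier, z.1 = enum α := by
    intro α s
    by_cases hs : P s
    swap
    · exact ⟨s, fun h => absurd h hs⟩
    obtain ⟨A', _, l, i, -, hA', hl, hi, -, hli, -, hD⟩ := exists_factor_card hLS hμ
      s.isStrongMap_fst s.isStrongMap_fst hs.1.le hs.1.le (by rw [hN]; exact Order.le_succ μ)
      {enum α} (by simpa using one_le_aleph0.trans hμ)
    obtain ⟨R, _, r, h, hr, hh, hrh⟩ := hAP s.graph.carrier A' s.model.carrier i s.snd hs.1 hA' hs.2
      hi s.isStrongMap_snd
    obtain ⟨R', _, k, r', h', hR', hk, hr', hh', rfl, rfl, -⟩ := exists_factor_card hLS hμ hr hh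
      hA'.le hs.2.le (by rw [← hA']; exact mk_le_of_injective hr.injective) ∅ (by simp)
    obtain ⟨t, θ, θ', hst, -, hθ'⟩ := s.exists_extension hi hl hr' hh'
      (fun z => congrFun hli z) (fun z => hk.injective (hrh z)) (by
        rw [SubModel.card_compl hμ hι _ hs.2.le, hR']
        exact Order.le_succ μ)
    obtain ⟨y, hy⟩ := hD rfl
    exact ⟨t, fun _ => ⟨hst, ⟨by rw [← hA']; exact (mk_congr θ'.toEquiv).symm,
      by rw [← hR']; exact (mk_congr θ.toEquiv).symm⟩, θ' y, (θ' y).2, by rw [hθ', hy]⟩⟩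
  choose G hG using hstep
  obtain ⟨M, hM, hbM, hGM, -⟩ := exists_tree P (fun _ _ => True) hbase (by
    intro α C hne hC hP
    obtain ⟨t, ht, htg, htm⟩ := EmbState.exists_iUnion hC
    obtain ⟨β⟩ := hne
    refine ⟨t, ⟨le_antisymm ?_ ?_, le_antisymm ?_ ?_⟩, ht, trivial⟩
    · rw [htg]
      exact SubModel.card_iUnion_le hμ (hIio α) fun β => (hP β).1.le
    · rw [← (hP β).1]
      exact SubModel.card_le (ht β).1
    · rw [htm]
      exact SubModel.card_iUnion_le hμ (hIio α) fun β => (hP β).2.le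
    · rw [← (hP β).2]
      exact SubModel.card_le (ht β).2) (fun α s _ => G α s)
    (fun α s _ hs => ⟨(hG α s hs).1, (hG α s hs).2.1⟩)
  set η : ι → Bool := fun _ => true
  have hmono : Monotone fun α => G α (M η α) := by
    intro α β hαβ
    rcases hαβ.eq_or_lt with rfl | hlt
    · exact le_rfl
    · exact (hGM η β α hlt).trans (hG β _ (hM η β)).1
  have hne : Nonempty ι := by
    rw [← mk_ne_zero_iff, hι]
    exact Order.succ_ne_bot _
  obtain ⟨t, ht, -, -⟩ := EmbState.exists_iUnion hmono
  obtain ⟨α₀⟩ := hne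
  have hbt : base ≤ t := ((hbM η α₀).trans (hG α₀ _ (hM η α₀)).1).trans (ht α₀)
  have hsurj : Function.Surjective t.fst := by
    intro y
    obtain ⟨z, hz, hzy⟩ := (hG (enum.symm y) _ (hM η _)).2.2
    exact ⟨⟨z, SubModel.mem_of_le (ht _).1 hz⟩, hzy.trans (enum.apply_symm_apply y)⟩
  obtain ⟨e, he⟩ := t.isStrongMap_fst.exists_equiv hsurj
  refine ⟨t.model.carrier, inferInstance, t.snd ∘ e.symm,
    Set.inclusion (SubModel.subset hbt.2) ∘ θ₀,
    t.isStrongMap_snd.comp (isStrongMap_equiv hf.mem_right e.symm),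
    (SubModel.isStrongMap hbt.2).comp (isStrongMap_equiv hg.mem_right θ₀), fun a => ?_⟩
  have h1 : e.symm (f a) = ⟨θ₀' a, SubModel.mem_of_le hbt.1 (θ₀' a).2⟩ := by
    apply e.injective
    rw [e.apply_symm_apply, he]
    exact (congrArg Prod.fst (hθ₀' a)).symm
  rw [Function.comp_apply, h1]
  exact Subtype.ext (congrArg Prod.snd (hθ₀' a))

end AEC

/-! ### Universality of the maximal model and density of minimal pre-types. -/

namespace AEC

open FirstOrder.Language

variable {L : FirstOrder.Language.{u, u}} {K : AEC L} {lam : Cardinal.{u}}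

/-- A model without proper extensions is universal over models one cardinal below. -/
theorem AmalgamationProperty.exists_map_of_maximal {μ : Cardinal.{u}}
    (hAP : K.AmalgamationProperty μ) (hLS : K.LS ≤ μ)
    (hμ : ℵ₀ ≤ μ) {N : Type u} [L.Structure N] (hN : #N = Order.succ μ)
    (hmax : ∀ (R : Type u) [L.Structure R] (g : N → R), K.IsStrongMap g → Function.Surjective g)
    {A B : Type u} [L.Structure A] [L.Structure B] {f : A → N} {g : A → B} (hA : #A = μ)
    (hB : #B = μ) (hf : K.IsStrongMap f) (hg : K.IsStrongMap g) :
    ∃ j : B → N, K.IsStrongMap j ∧ ∀ a, j (g a) = f a := by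
  obtain ⟨R, _, f', g', hf', hg', h⟩ := hAP.amalgamable_succ hLS hμ hA hB hN hf hg
  obtain ⟨e, rfl⟩ := hf'.exists_equiv (hmax R f' hf')
  refine ⟨e.symm ∘ g', (isStrongMap_equiv hg'.mem_right e.symm).comp hg', fun a => ?_⟩
  rw [Function.comp_apply, ← h, e.symm_apply_apply]

/-- A model of cardinality `lam⁺⁺` without proper extensions is universal over its submodels of
cardinality `lam`. -/
theorem exists_map_of_maximal {N : Type u} [L.Structure N] (hAP : K.AmalgamationProperty lam)
    (hAP' : K.AmalgamationProperty (Order.succ lam)) (hLS : K.LS ≤ lam) (hinf : ℵ₀ ≤ lam)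
    (hN : #N = Order.succ (Order.succ lam))
    (hmax : ∀ (R : Type u) [L.Structure R] (g : N → R), K.IsStrongMap g → Function.Surjective g)
    {A B : Type u} [L.Structure A] [L.Structure B] {f : A → N} {g : A → B} (hA : #A = lam)
    (hB : #B = lam) (hf : K.IsStrongMap f) (hg : K.IsStrongMap g) :
    ∃ j : B → N, K.IsStrongMap j ∧ ∀ a, j (g a) = f a := by
  have hle : lam ≤ Order.succ lam := Order.le_succ _
  have hLS' := hLS.trans hle
  have hinf' := hinf.trans hle
  -- An intermediate `N₁` of cardinality `λ⁺` bridges the gap of two cardinals: `B` is amalgamated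
  -- with `N₁` by amalgamation in `λ`, and the result is embedded in `N` over `N₁` by amalgamation
  -- in `λ⁺`.
  obtain ⟨N₁, _, i, f₁, -, hN₁, hi, hf₁, -, rfl, -⟩ := exists_factor_card hLS' hinf' hf hf
    (hA.le.trans hle) (hA.le.trans hle) (by rw [hN]; exact Order.le_succ _) ∅ (by simp)
  obtain ⟨R, _, p, q, hp, hq, hpq⟩ := hAP.amalgamable_succ hLS hinf hA hB hN₁ hf₁ hg
  obtain ⟨R', _, k, p', q', hR', hk, hp', hq', rfl, rfl, -⟩ := exists_factor_card hLS' hinf' hp hq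
    hN₁.le (hB.le.trans hle) (by rw [← hN₁]; exact mk_le_of_injective hp.injective) ∅ (by simp)
  obtain ⟨j, hj, hji⟩ := hAP'.exists_map_of_maximal hLS' hinf' hN hmax hN₁ hR' hi hp'
  refine ⟨j ∘ q', hj.comp hq', fun a => ?_⟩
  have := hk.injective (hpq a)
  rw [Function.comp_apply, ← this, hji, Function.comp_apply]

namespace PreType

/-- Two pre-types above `p` with the same base `M₁` have the same type if `M₀ → M₁` is onto. -/
theorem tp_eq_of_surjective {M₀ M₁ : Type u} [L.Structure M₀] [L.Structure M₁]
    {p : K.PreType lam M₀} {q₁ q₂ : K.PreType lam M₁} {h₀ : M₀ ↪[L] M₁} {h₁ : p.N ↪[L] q₁.N}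
    {h₂ : p.N ↪[L] q₂.N} (hq₁ : LeVia p q₁ h₀ h₁) (hq₂ : LeVia p q₂ h₀ h₂)
    (hs : Function.Surjective h₀) : q₁.tp = q₂.tp := by
  obtain ⟨e, he⟩ := hq₁.1.isStrongMap.exists_equiv hs
  have hemb : K.IsEmb (p.emb.comp e.symm.toEmbedding) := isStrongMap_coe.1
    (p.isEmb.isStrongMap.comp (isStrongMap_equiv hq₁.1.isStrongMap.mem_right e.symm))
  have hsymm : ∀ x, h₀ (e.symm x) = x := fun x => by rw [← he, e.apply_symm_apply]
  let p' : K.PreType lam M₁ :=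
    { N := p.N
      card_base := q₁.card_base
      card_top := p.card_top
      emb := p.emb.comp e.symm.toEmbedding
      isEmb := hemb
      a := p.a
      a_notMem := by
        rintro ⟨x, hx⟩
        exact p.a_notMem ⟨e.symm x, hx⟩ }
  have key : ∀ (q : K.PreType lam M₁) (h : p.N ↪[L] q.N), LeVia p q h₀ h → p'.tp = q.tp := by
    intro q h hq
    refine Quotient.sound (Relation.TransGen.single ⟨q.N, q.str, h, Embedding.refl L q.N, hq.2.1,
      K.isEmb_refl (K.mem_of_strong q.isEmb).2, fun x => ?_, hq.2.2.2⟩)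
    change h (p.emb (e.symm x)) = q.emb x
    rw [hq.2.2.1, hsymm]
  exact (key q₁ h₁ hq₁).symm.trans (key q₂ h₂ hq₂)

theorem Le.trans {M₀ M₁ M₂ : Type u} [L.Structure M₀] [L.Structure M₁] [L.Structure M₂]
    {p : K.PreType lam M₀} {q : K.PreType lam M₁} {r : K.PreType lam M₂} (hpq : p.Le q)
    (hqr : q.Le r) : p.Le r := by
  obtain ⟨h₀, h, h1, h2, h3, h4⟩ := hpq
  obtain ⟨k₀, k, k1, k2, k3, k4⟩ := hqr
  refine ⟨k₀.comp h₀, k.comp h, IsEmb.comp K h1 k1, IsEmb.comp K h2 k2, fun x => ?_, ?_⟩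
  · rw [Embedding.comp_apply, h3, k3, Embedding.comp_apply]
  · rw [Embedding.comp_apply, h4, k4]

theorem le_of_maps {M₀ M₁ : Type u} [L.Structure M₀] [L.Structure M₁]
    {p : K.PreType lam M₀} {q : K.PreType lam M₁} {h₀ : M₀ → M₁} {h : p.N → q.N}
    (hh₀ : K.IsStrongMap h₀) (hh : K.IsStrongMap h) (hc : ∀ x, h (p.emb x) = q.emb (h₀ x))
    (ha : h p.a = q.a) : p.Le q := by
  obtain ⟨h₀, rfl, hh₀⟩ := hh₀
  obtain ⟨h, rfl, hh⟩ := hh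
  exact ⟨h₀, h, hh₀, hh, hc, ha⟩

end PreType

namespace EmbState

variable {N ι : Type u} [L.Structure N]

/-- The pre-type `(a, graph, model)`. -/
noncomputable def toPreType (s : K.EmbState N ι) (hg : #s.graph.carrier = lam)
    (hm : #s.model.carrier = lam) (a : s.model.carrier) (ha : ∀ z, s.snd z ≠ a) :
    K.PreType lam s.graph.carrier where
  N := s.model.carrier
  card_base := hg
  card_top := hm
  emb := s.isStrongMap_snd.choose
  isEmb := s.isStrongMap_snd.choose_spec.2
  a := a
  a_notMem := by
    rw [s.isStrongMap_snd.choose_spec.1]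
    rintro ⟨z, hz⟩
    exact ha z hz

theorem toPreType_emb (s : K.EmbState N ι) (hg : #s.graph.carrier = lam)
    (hm : #s.model.carrier = lam) (a : s.model.carrier) (ha : ∀ z, s.snd z ≠ a)
    (z : s.graph.carrier) : (s.toPreType hg hm a ha).emb z = s.snd z :=
  congrFun s.isStrongMap_snd.choose_spec.1 z

/-- A pre-type that is not minimal has two extensions over the same subset of `N` which cannot be
realized in `N` by the same element. -/
theorem exists_split (hinf : ℵ₀ ≤ lam) (hι : #ι = Order.succ lam)
    (huniv : ∀ {A B : Type u} [L.Structure A] [L.Structure B] {f : A → N} {g : A → B},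
      #A = lam → #B = lam → K.IsStrongMap f → K.IsStrongMap g →
      ∃ j : B → N, K.IsStrongMap j ∧ ∀ a, j (g a) = f a)
    (s : K.EmbState N ι) (hg : #s.graph.carrier = lam) (hm : #s.model.carrier = lam)
    (a : s.model.carrier) (ha : ∀ z, s.snd z ≠ a) (hp : ¬ (s.toPreType hg hm a ha).Minimal) :
    ∃ G : Bool → K.EmbState N ι,
      (∀ b, s ≤ G b ∧ #(G b).graph.carrier = lam ∧ #(G b).model.carrier = lam ∧
        (∀ z, ((G b).snd z : ι) ≠ a) ∧ ¬ (G b).graph.carrier ⊆ s.graph.carrier) ∧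
      ∀ g : ∀ b, (G b).model.carrier → N, (∀ b, K.IsStrongMap (g b)) →
        (∀ b z, g b ((G b).snd z) = (G b).fst z) →
        ∀ h₀ h₁, g false ⟨a, h₀⟩ ≠ g true ⟨a, h₁⟩ := by
  simp only [PreType.Minimal] at hp
  push Not at hp
  obtain ⟨M₁, _, q₁, q₂, h₀, h₁, h₂, hq₁, hq₂, hne⟩ := hp
  -- The common base `M₁` of the two extensions is placed in `N` once, so both new states have the
  -- same base there.
  obtain ⟨j, hj, hjs⟩ := huniv hg q₁.card_base s.isStrongMap_fst hq₁.1.isStrongMap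
  have hnsurj : ¬ Function.Surjective h₀ := fun hs =>
    hne (PreType.tp_eq_of_surjective hq₁ hq₂ hs)
  have key : ∀ (q : K.PreType lam M₁) (h : (s.toPreType hg hm a ha).N ↪[L] q.N),
      PreType.LeVia (s.toPreType hg hm a ha) q h₀ h →
      ∃ (t : K.EmbState N ι) (θ : q.N ≃[L] t.model.carrier) (θ' : M₁ ≃[L] t.graph.carrier),
        (θ q.a : ι) = a ∧ (∀ x, t.fst (θ' x) = j x) ∧ (∀ x, t.snd (θ' x) = θ (q.emb x)) ∧
        (s ≤ t ∧ #t.graph.carrier = lam ∧ #t.model.carrier = lam ∧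
        (∀ z, (t.snd z : ι) ≠ a) ∧ ¬ t.graph.carrier ⊆ s.graph.carrier) := by
    intro q h hq
    obtain ⟨t, θ, θ', hst, hθ, hθ'⟩ := s.exists_extension hq.1.isStrongMap hj q.isEmb.isStrongMap
      hq.2.1.isStrongMap hjs
      (fun z => by rw [← s.toPreType_emb hg hm a ha]; exact (hq.2.2.1 z).symm) (by
        rw [SubModel.card_compl hinf hι _ hm.le, q.card_top]
        exact Order.le_succ _)
    have hθa : (θ q.a : ι) = a := by
      rw [← hq.2.2.2]
      exact hθ _
    have hsnd : ∀ x, t.snd (θ' x) = θ (q.emb x) := fun x =>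
      Subtype.ext (congrArg Prod.snd (hθ' x))
    refine ⟨t, θ, θ', hθa, fun x => congrArg Prod.fst (hθ' x), hsnd, hst, ?_, ?_, ?_, ?_⟩
    · rw [← q.card_base]
      exact (mk_congr θ'.toEquiv).symm
    · rw [← q.card_top]
      exact (mk_congr θ.toEquiv).symm
    · intro z hz
      obtain ⟨x, rfl⟩ := θ'.surjective z
      rw [hsnd, ← hθa] at hz
      exact q.a_notMem ⟨x, θ.injective (Subtype.ext hz)⟩
    · intro hsub
      refine hnsurj fun x => ⟨⟨θ' x, hsub (θ' x).2⟩, hj.injective ?_⟩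
      rw [hjs]
      exact congrArg Prod.fst (hθ' x)
  obtain ⟨t₁, θ₁, θ₁', ha₁, hf₁, hs₁, ht₁⟩ := key q₁ h₁ hq₁
  obtain ⟨t₂, θ₂, θ₂', ha₂, hf₂, hs₂, ht₂⟩ := key q₂ h₂ hq₂
  refine ⟨fun b => cond b t₂ t₁, by rintro (_ | _) <;> assumption, fun g hgs hgc k₀ k₁ hga => hne ?_⟩
  have hθ₁ : K.IsStrongMap θ₁ := isStrongMap_equiv q₁.isEmb.isStrongMap.mem_right θ₁
  have hθ₂ : K.IsStrongMap θ₂ := isStrongMap_equiv q₂.isEmb.isStrongMap.mem_right θ₂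
  obtain ⟨e₁, he₁, he₁'⟩ := (hgs false).comp hθ₁
  obtain ⟨e₂, he₂, he₂'⟩ := (hgs true).comp hθ₂
  -- If both tops map into `N` over the base with the same image of `a`, then `N` witnesses that the
  -- two types are equal.
  refine Quotient.sound (Relation.TransGen.single ⟨N, inferInstance, e₁, e₂, he₁', he₂', ?_, ?_⟩)
  · intro x
    rw [he₁, he₂, Function.comp_apply, Function.comp_apply, ← hs₁, ← hs₂]
    exact ((hgc false _).trans (hf₁ x)).trans ((hgc true _).trans (hf₂ x)).symm
  · rw [he₁, he₂, Function.comp_apply, Function.comp_apply,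
      show θ₁ q₁.a = ⟨a, k₀⟩ from Subtype.ext ha₁, show θ₂ q₂.a = ⟨a, k₁⟩ from Subtype.ext ha₂]
    exact hga

end EmbState

/-- Minimal pre-types are dense if there is a model of cardinality `lam⁺⁺ < 2 ^ lam⁺` without
proper extensions, and amalgamation holds in `lam` and `lam⁺`. -/
theorem minimalDense_of_maximal {N : Type u} [L.Structure N] (hNmem : K.Mem N)
    (hcat : K.Categorical lam) (hAP : K.AmalgamationProperty lam)
    (hAP' : K.AmalgamationProperty (Order.succ lam)) (hLS : K.LS ≤ lam) (hinf : ℵ₀ ≤ lam)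
    (hN : #N = Order.succ (Order.succ lam))
    (h3 : Order.succ (Order.succ lam) < (2 : Cardinal.{u}) ^ Order.succ lam)
    (hmax : ∀ (R : Type u) [L.Structure R] (g : N → R), K.IsStrongMap g → Function.Surjective g) :
    K.MinimalDense lam := by
  intro M₀ _ p
  by_contra! hcon
  obtain ⟨ι, _, _, hι, hIio⟩ := exists_wellOrder_succ lam
  have hle : lam ≤ Order.succ lam := Order.le_succ _
  have hne : Nonempty ι := by
    rw [← mk_ne_zero_iff, hι]
    exact Order.succ_ne_bot _
  obtain ⟨S, hS, -, hScard⟩ := K.exists_strongMap_of_LS_le hLS hNmem ∅ (by simp)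
    (by rw [hN]; exact hle.trans (Order.le_succ _))
  obtain ⟨e⟩ := hcat M₀ S p.isEmb.isStrongMap.mem_left (K.mem_of_strong hS).1 p.card_base hScard
  have hl : K.IsStrongMap (Subtype.val ∘ e) :=
    (isStrongMap_subtype hS).comp (isStrongMap_equiv p.isEmb.isStrongMap.mem_left e)
  obtain ⟨model, ⟨θ⟩⟩ := SubModel.exists_copy (Ω := ι) p.isEmb.isStrongMap.mem_right
    (by rw [p.card_top, hι]; exact hle)
  obtain ⟨base, θ', rfl, hθ'⟩ := EmbState.exists_of_maps hl p.isEmb.isStrongMap θ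
  set a : ι := (θ p.a).val
  let P : K.EmbState N ι → Prop := fun s => #s.graph.carrier = lam ∧ #s.model.carrier = lam ∧
    base ≤ s ∧ ∀ z, (s.snd z : ι) ≠ a
  have hbase : P base := by
    refine ⟨?_, ?_, le_rfl, fun z hz => ?_⟩
    · rw [← p.card_base]
      exact (mk_congr θ'.toEquiv).symm
    · rw [← p.card_top]
      exact (mk_congr θ.toEquiv).symm
    · obtain ⟨x, rfl⟩ := θ'.surjective z
      refine p.a_notMem ⟨x, θ.injective (Subtype.ext ?_)⟩
      exact (congrArg Prod.snd (hθ' x)).symm.trans hz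
  have hstep : ∀ s : K.EmbState N ι, ∃ G : Bool → K.EmbState N ι, P s →
      (∀ b, s ≤ G b ∧ P (G b) ∧ ¬ (G b).graph.carrier ⊆ s.graph.carrier) ∧
      ∀ g : ∀ b, (G b).model.carrier → N, (∀ b, K.IsStrongMap (g b)) →
        (∀ b z, g b ((G b).snd z) = (G b).fst z) →
        ∀ h₀ h₁, g false ⟨a, h₀⟩ ≠ g true ⟨a, h₁⟩ := by
    intro s
    by_cases hs : P s
    swap
    · exact ⟨fun _ => s, fun h => absurd h hs⟩
    obtain ⟨hg, hm, hbs, hsa⟩ := hs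
    have hs_ne : ∀ z, s.snd z ≠ ⟨a, SubModel.mem_of_le hbs.2 (θ p.a).2⟩ := fun z hz =>
      hsa z (congrArg Subtype.val hz)
    have hle : p.Le (s.toPreType hg hm _ hs_ne) := by
      refine PreType.le_of_maps (h₀ := Set.inclusion (SubModel.subset hbs.1) ∘ θ')
        (h := Set.inclusion (SubModel.subset hbs.2) ∘ θ)
        ((SubModel.isStrongMap hbs.1).comp (isStrongMap_equiv p.isEmb.isStrongMap.mem_left θ'))
        ((SubModel.isStrongMap hbs.2).comp (isStrongMap_equiv p.isEmb.isStrongMap.mem_right θ))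
        (fun x => ?_) rfl
      rw [EmbState.toPreType_emb]
      exact Subtype.ext (congrArg Prod.snd (hθ' x)).symm
    obtain ⟨G, hG, hG'⟩ := s.exists_split hinf hι
      (fun hA hB hf hg => exists_map_of_maximal hAP hAP' hLS hinf hN hmax hA hB hf hg)
      hg hm _ hs_ne (hcon _ _ _ hle)
    exact ⟨G, fun _ => ⟨fun b => ⟨(hG b).1, ⟨(hG b).2.1, (hG b).2.2.1, hbs.trans (hG b).1,
      (hG b).2.2.2.1⟩, (hG b).2.2.2.2⟩, hG'⟩⟩
  choose G hG hG' using hstep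
  obtain ⟨M, hM, -, hGM, hcongr, -⟩ := exists_tree (ι := ι) P (fun _ _ => True) hbase (by
    intro α C hne hC hP
    obtain ⟨t, ht, htg, htm⟩ := EmbState.exists_iUnion hC
    obtain ⟨β⟩ := hne
    refine ⟨t, ⟨le_antisymm ?_ ?_, le_antisymm ?_ ?_, (hP β).2.2.1.trans (ht β), ?_⟩, ht, trivial⟩
    · rw [htg]
      exact SubModel.card_iUnion_le hinf (hIio α) fun β => (hP β).1.le
    · rw [← (hP β).1]
      exact SubModel.card_le (ht β).1
    · rw [htm]
      exact SubModel.card_iUnion_le hinf (hIio α) fun β => (hP β).2.1.le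
    · rw [← (hP β).2.1]
      exact SubModel.card_le (ht β).2
    · intro z hz
      obtain ⟨γ, hγ⟩ := Set.mem_iUnion.1 (htg.subset z.2)
      exact (hP γ).2.2.2 ⟨z, hγ⟩ hz) (fun _ => G)
    (fun _ s b hs => ⟨(hG s hs b).1, (hG s hs b).2.1⟩)
  have hmono : ∀ η, Monotone fun α => G (M η α) (η α) := by
    intro η α β hαβ
    rcases hαβ.eq_or_lt with rfl | hlt
    · exact le_rfl
    · exact (hGM η β α hlt).trans (hG _ (hM η β) _).1
  choose t ht htg htm using fun η => EmbState.exists_iUnion (hmono η)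
  have hinf' := hinf.trans hle
  have htgc : ∀ η, #(t η).graph.carrier = Order.succ lam := by
    intro η
    refine le_antisymm ?_ ?_
    · rw [htg]
      exact SubModel.card_iUnion_le hinf' hι.le fun α => (hG _ (hM η α) _).2.1.1.le.trans hle
    · rw [← hι]
      exact SubModel.card_le_of_strictly_increasing (fun α => (hG _ (hM η α) (η α)).2.2)
        (fun α β h => SubModel.subset (hGM η β α h).1) fun α => SubModel.subset (ht η α).1
  have htmc : ∀ η, #(t η).model.carrier = Order.succ lam := fun η =>
    le_antisymm ((mk_set_le _).trans hι.le)
      (by rw [← htgc η]; exact mk_le_of_injective (t η).isStrongMap_snd.injective)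
  -- Strict growth of the bases, which comes from splitting, gives base and top of each branch
  -- cardinality exactly `λ⁺`, as amalgamation in `λ⁺` requires.
  choose g hg hgs using fun η => hAP'.exists_map_of_maximal (hLS.trans hle) hinf' hN hmax (htgc η)
    (htmc η) (t η).isStrongMap_fst (t η).isStrongMap_snd
  obtain ⟨α₀⟩ := hne
  have hbt : ∀ η, base ≤ t η := fun η =>
    ((hM η α₀).2.2.1.trans (hG _ (hM η α₀) _).1).trans (ht η α₀)
  have hinj : Function.Injective fun η => g η ⟨a, SubModel.mem_of_le (hbt η).2 (θ p.a).2⟩ := by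
    intro η ν hην
    by_contra hne
    obtain ⟨δ, hδ, hmin⟩ := (wellFounded_lt (α := ι)).has_min {δ | η δ ≠ ν δ}
      (Function.ne_iff.1 hne)
    have hm : M η δ = M ν δ := hcongr η ν δ fun β hβ => by
      by_contra h
      exact hmin β h hβ
    have main : ∀ ξ ζ : ι → Bool, M ξ δ = M ζ δ → ξ δ = false → ζ δ = true →
        g ξ ⟨a, SubModel.mem_of_le (hbt ξ).2 (θ p.a).2⟩ ≠
          g ζ ⟨a, SubModel.mem_of_le (hbt ζ).2 (θ p.a).2⟩ := by
      intro ξ ζ hm hξ hζ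
      have h0 := ht ξ δ
      have h1 := ht ζ δ
      rw [hξ] at h0
      rw [← hm, hζ] at h1
      have hP := hM ξ δ
      have hmem : ∀ b, a ∈ (G (M ξ δ) b).model.carrier := fun b =>
        SubModel.mem_of_le (hP.2.2.1.trans (hG _ hP b).1).2 (θ p.a).2
      exact hG' _ hP (fun b => match b with
        | false => g ξ ∘ Set.inclusion (SubModel.subset h0.2)
        | true => g ζ ∘ Set.inclusion (SubModel.subset h1.2))
        (by
          rintro (_ | _)
          · exact (hg ξ).comp (SubModel.isStrongMap h0.2)
          · exact (hg ζ).comp (SubModel.isStrongMap h1.2))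
        (by
          rintro (_ | _) z
          · exact hgs ξ ⟨z, SubModel.mem_of_le h0.1 z.2⟩
          · exact hgs ζ ⟨z, SubModel.mem_of_le h1.1 z.2⟩) (hmem _) (hmem _)
    cases h₁ : η δ <;> cases h₂ : ν δ
    · exact hδ (h₁.trans h₂.symm)
    · exact main η ν hm h₁ h₂ hην
    · exact main ν η hm.symm h₂ h₁ hην.symm
    · exact hδ (h₁.trans h₂.symm)
  have := mk_le_of_injective hinj
  simp only [mk_pi, mk_bool, prod_const, hι, hN] at this
  exact absurd h3 (not_lt.2 (by simpa using this))

end AEC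

theorem mainTheorem8 {L : FirstOrder.Language.{u, u}} (K : AEC L) (lam : Cardinal.{u})
    (hinf : ℵ₀ ≤ lam) (hLS : K.LS ≤ lam)
    (h₁ : (2 : Cardinal.{u}) ^ lam < 2 ^ Order.succ lam)
    (h₂ : (2 : Cardinal.{u}) ^ Order.succ lam < 2 ^ Order.succ (Order.succ lam))
    (h₃ : Order.succ (Order.succ lam) < (2 : Cardinal.{u}) ^ Order.succ lam)
    (hstar : K.Star lam)
    (hempty : IsEmpty (K.Models (Order.succ (Order.succ (Order.succ lam))))) :
    K.MinimalDense lam ∧ (K.sMin lam).WeakDensity := by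
  obtain ⟨hI₀, hI₁, hI₂, hI₃⟩ := hstar
  have hle : lam ≤ Order.succ lam := Order.le_succ _
  have hinf' := hinf.trans hle
  have hLS' := hLS.trans hle
  have hex₂ := AEC.exists_model_of_one_le_numModels hI₂
  have hAP : K.AmalgamationProperty lam :=
    AEC.amalgamationProperty_of_numModels_lt hLS hinf h₁ (AEC.categorical_of_numModels_eq_one hI₀)
      (AEC.exists_model_of_one_le_numModels hI₁.ge) (by
        rw [hI₁, one_lt_lift_iff]
        exact one_lt_aleph0.trans_le ((hinf.trans (cantor lam).le).trans h₁.le))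
  have hAP' : K.AmalgamationProperty (Order.succ lam) :=
    AEC.amalgamationProperty_of_numModels_lt hLS' hinf' h₂
      (AEC.categorical_of_numModels_eq_one hI₁) hex₂ hI₃
  obtain ⟨N, _, hN, hNcard, hmax⟩ := AEC.exists_maximal (hLS'.trans (Order.le_succ _))
    (hinf'.trans (Order.le_succ _)) hex₂ hempty
  have hdense : K.MinimalDense lam :=
    AEC.minimalDense_of_maximal hN (AEC.categorical_of_numModels_eq_one hI₀) hAP hAP' hLS hinf
      hNcard h₃ hmax
  refine ⟨hdense, fun M N _ _ hM hN i hi hns => ?_⟩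
  -- Any element outside the image of `M` will do, since density applies to every pre-type.
  obtain ⟨a, ha⟩ := not_forall.1 hns
  obtain ⟨M', _, q, hq, hmin⟩ := hdense M
    { N := N, card_base := hM, card_top := hN, emb := i, isEmb := hi, a := a, a_notMem := ha }
  exact ⟨a, ha, M', _, q, hq, q, hmin, rfl⟩
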